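/- Let $q$ be a prime power and let $\mathrm{PG}(n,q)$ be the $n$-dimensional projective space over the field with $q$ elements; dimensions below are projective, so points, lines, planes and solids have dimension $0,1,2,3$. For integers $n,d$ let $$\binom{n}{d}_q:=\prod_{i=1}^{d}\frac{q^{n+1-i}-1}{q^i-1}\ \text{ if }0\le d\le n,\qquad \binom{n}{d}_q:=0\ \text{ otherwise},$$ and put $s(d,n):=\binom{n+1}{d+1}_q$ and $s(n):=s(0,n)$. A flag of $\mathrm{PG}(n,q)$ is a set $F$ of subspaces of $\mathrm{PG}(n,q)$, different from $\emptyset$ and from $\mathrm{PG}(n,q)$, any two of which are comparable under inclusion; its type is $\{\dim U: U\in F\}$. Two flags $F_1,F_2$ of $\mathrm{PG}(n,q)$ are in general position if $U_1\cap U_2=\emptyset$ or $\langle U_1,U_2\rangle=\mathrm{PG}(n,q)$ for all $U_1\in F_1$, $U_2\in F_2$. The Kneser graph of flags of type $T$ of $\mathrm{PG}(n,q)$ is the simple graph whose vertices are the flags of type $T$, two flags being adjacent if and only if they are in general position. The Kneser graph of $i$-dimensional subspaces is the case $T=\{i\}$, the flag $\{U\}$ being identified with $U$. A flag $\{E,S\}$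 of type $\{2,3\}$ is also written $(E,S)$, where $E$ is the plane and $S$ the solid. Maximal independent sets are those that are maximal with respect to inclusion. Let $\Gamma$ be the Kneser graph of flags of type $\{2,3\}$ of $\mathrm{PG}(6,q)$ and let $H$ be a hyperplane of $\mathrm{PG}(6,q)$. For a set $\mathcal E$ of planes of $H$, let $\Lambda(H,\mathcal E)$ be the set of all flags $(E,S)$ of type $\{2,3\}$ of $\mathrm{PG}(6,q)$ that satisfy $S\subseteq H$ or $E\in\mathcal E$. The Kneser graph of planes of $H$ is formed in $H\cong\mathrm{PG}(5,q)$ (so two planes of $H$ are adjacent if and only if they are disjoint). Then the following hold. (i) $\Lambda(H,\emptyset)$ is an independent set of $\Gamma$. (ii) The maximal independent sets of $\Gamma$ that contain $\Lambda(H,\emptyset)$ are exactly the sets $\Lambda(H,\mathcal E)$ with $\mathcal E$ a maximal independent set of the Kneser graph of planes of $H$. (iii) For every maximal independent set $\mathcal E$ of the Kneser graph of planes of $H$ we have $$|\Lambda(H,\mathcal E)|=s(3,5)\cdot s(3)+|\mathcal E|\cdot q^3\le q^{11}+2q^{10}+5q^9+7q^8+10q^7+11q^6+11q^5+9q^4+7q^3+4q^2+2q+1.$$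 Equality holds in this bound if and only if $|\mathcal E|=s(1,4)$. If equality holds, then either there is a point $P$ of $H$ such that $\mathcal E$ consists of all planes of $H$ that contain $P$, or there is a $4$-dimensional subspace $U$ of $H$ such that $\mathcal E$ consists of all planes of $U$. -/

import Mathlib

namespace KneserPG

/-! Projective geometry is described through the lattice of subspaces of a vector space `V` over
a field `K`. The projective space `PG(W)` of a subspace `W` of `V` has the subspaces of `W` as its
subspaces; the projective dimension is the vector space dimension minus one, the empty projective
subspace is `⊥`, the intersection is `⊓` and the span is `⊔`. Hence `PG(n, q)` is
`PG(⊤)` when `V` has dimension `n + 1` over a field with `q` elements. -/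

section Geometry

variable {K V : Type*} [Field K] [AddCommGroup V] [Module K V]

/-- `U` has projective dimension `d`. -/
def HasProjDim (U : Submodule K V) (d : ℕ) : Prop :=
  Module.finrank K U = d + 1

/-- A flag of `PG(W)`: a set of non-trivial subspaces of `PG(W)`, any two of which are
comparable. -/
def IsFlag (W : Submodule K V) (F : Set (Submodule K V)) : Prop :=
  (∀ U ∈ F, U ≤ W ∧ U ≠ ⊥ ∧ U ≠ W) ∧ ∀ U ∈ F, ∀ U' ∈ F, U ≤ U' ∨ U' ≤ U

/-- The type of a flag: the set of the projective dimensions of its members. -/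
def flagType (F : Set (Submodule K V)) : Set ℕ :=
  {d | ∃ U ∈ F, HasProjDim U d}

/-- The flags of type `T` of `PG(W)`. -/
abbrev FlagOfType (W : Submodule K V) (T : Set ℕ) : Type _ :=
  {F : Set (Submodule K V) // IsFlag W F ∧ flagType F = T}

/-- The subspaces of projective dimension `i` of `PG(W)`. -/
abbrev SubspaceOfDim (W : Submodule K V) (i : ℕ) : Type _ :=
  {U : Submodule K V // U ≤ W ∧ HasProjDim U i}

/-- Two flags of `PG(W)` are in general position if any member of the first and any member of the
second are disjoint or span `PG(W)`. -/
def GeneralPosition (W : Submodule K V) (F F' : Set (Submodule K V)) : Prop :=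
  ∀ U ∈ F, ∀ U' ∈ F', U ⊓ U' = ⊥ ∨ U ⊔ U' = W

theorem GeneralPosition.symm {W : Submodule K V} {F F' : Set (Submodule K V)}
    (h : GeneralPosition W F F') : GeneralPosition W F' F := by
  intro U hU U' hU'
  rw [inf_comm, sup_comm]
  exact h U' hU' U hU

/-- The Kneser graph of flags of type `T` of `PG(W)`. -/
def kneserGraph (W : Submodule K V) (T : Set ℕ) : SimpleGraph (FlagOfType W T) where
  Adj F F' := F ≠ F' ∧ GeneralPosition W F.1 F'.1
  symm := ⟨fun _ _ h => ⟨h.1.symm, h.2.symm⟩⟩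
  loopless := ⟨fun _ h => h.1 rfl⟩

/-- The Kneser graph of `i`-dimensional subspaces of `PG(W)`: a subspace `U` is identified with
the flag `{U}` of type `{i}`. -/
def kneserGraphSubspaces (W : Submodule K V) (i : ℕ) : SimpleGraph (SubspaceOfDim W i) where
  Adj U U' := U ≠ U' ∧ GeneralPosition W {U.1} {U'.1}
  symm := ⟨fun _ _ h => ⟨h.1.symm, h.2.symm⟩⟩
  loopless := ⟨fun _ h => h.1 rfl⟩

/-- `Λ(H, 𝓔)`: all flags `(E, S)` of type `{2, 3}` of `PG(V)` whose solid `S` lies in `H` or whose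
plane `E` belongs to the set `𝓔` of planes of `H`. -/
def Lam (H : Submodule K V) (𝓔 : Set (SubspaceOfDim H 2)) :
    Set (FlagOfType (⊤ : Submodule K V) {2, 3}) :=
  {F | (∃ S ∈ F.1, HasProjDim S 3 ∧ S ≤ H) ∨ ∃ E ∈ 𝓔, E.1 ∈ F.1}

end Geometry

/-- The Gaussian coefficient `[n choose d]_q`. -/
noncomputable def gauss (q : ℕ) (n d : ℤ) : ℚ :=
  if 0 ≤ d ∧ d ≤ n then ∏ i ∈ Finset.Icc 1 d, ((q : ℚ) ^ (n + 1 - i) - 1) / ((q : ℚ) ^ i - 1)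
  else 0

/-- `s_q(l, k, d, n) = q ^ ((l + 1) (d - k)) * [n - k - l - 1 choose d - k]_q`. -/
noncomputable def s4 (q : ℕ) (l k d n : ℤ) : ℚ :=
  (q : ℚ) ^ ((l + 1) * (d - k)) * gauss q (n - k - l - 1) (d - k)

/-- `s_q(d, n) = s_q(-1, -1, d, n)`, the number of `d`-dimensional subspaces of `PG(n, q)`. -/
noncomputable def s2 (q : ℕ) (d n : ℤ) : ℚ := s4 q (-1) (-1) d n

/-- `s_q(n) = s_q(0, n)`, the number of points of `PG(n, q)`. -/
noncomputable def s1 (q : ℕ) (n : ℤ) : ℚ := s2 q 0 n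

end KneserPG

/-! The geometric part rests on two facts about a hyperplane `H` of the six-dimensional projective
space. A flag whose plane does not lie in `H` is in general position to some flag whose solid lies
in `H` (`exists_adj_of_not_le`), and flags through disjoint planes of `H` whose solids are not in
`H` are in general position (`adj_of_inf_eq_bot`). Hence an independent set containing `Λ(H, ∅)` is
contained in `Λ(H, 𝓔)` for an independent set `𝓔` of planes of `H` (`exists_subset_Lam`), and
conversely all these sets are independent (`isIndepSet_Lam`).

The numerical part reduces to the Erdős–Ko–Rado theorem for planes of a five-dimensional projective
space, including its case of equality (`erdosKoRado_planes`). The images of the Desarguesian spread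
`L × L`, with `L` a cubic extension of `K`, consist of `q ^ 3 + 1` disjoint planes and contain at
most one member of a set `𝓔` of pairwise intersecting planes. Averaging over all images gives the
bound, and in the case of equality every image contains exactly one member of `𝓔`. Averaging then
only over the images in a fixed position to a given plane `π` gives two linear relations between
the numbers of members of `𝓔` meeting `π` in the different dimensions
(`spread_bound_and_relations`). Together with double counting they show that the indicator function
of `𝓔` is a sum over points: with a suitable weight on the points, the total weight of a plane is
one if it belongs to `𝓔` and zero otherwise (`IsExtremal.weightSum_plane`).

The weight of a line determines the number of members of `𝓔` through it. If some member misses the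
line, this number is at most `q ^ 2 + q + 1`; if all members meet the line, its weight is one. This
leaves two cases.

* If no line has weight one, then all lines in a member of `𝓔` have the same weight, as they attain
  the upper bound on average. So all points covered by `𝓔` have the same weight, and these points
  form a proper subspace (`IsExtremal.exists_ne_top_of_forall_line`).
* If some line has weight one, then a second such line meets it in a point `P`. The members of `𝓔`
  that do not contain `P` meet the plane of the two lines in a line, and there are too few planes
  for any such member to exist (`IsExtremal.le_of_two_lines`). -/

namespace KneserPG

open Module

/-! ### Counting subspaces between two subspaces -/

section Counting

variable {K W : Type*} [Field K] [Finite K] [AddCommGroup W] [Module K W]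

theorem card_finrank_mul [Finite W] {n k : ℕ} (hn : finrank K W = n) (hk : k ≤ n) :
    (Nat.card {X : Submodule K W // finrank K X = k} : ℚ) *
        ∏ i : Fin k, ((Nat.card K : ℚ) ^ k - (Nat.card K : ℚ) ^ (i : ℕ)) =
      ∏ i : Fin k, ((Nat.card K : ℚ) ^ n - (Nat.card K : ℚ) ^ (i : ℕ)) := by
  classical
  have := Fintype.ofFinite K
  have hq : 1 ≤ Fintype.card K := Fintype.card_pos
  have key : ∀ {M : Type _} [AddCommGroup M] [Module K M] [Finite M] {m : ℕ}, finrank K M = m →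
      k ≤ m → (Nat.card {s : Fin k → M // LinearIndependent K s} : ℚ) =
        ∏ i : Fin k, ((Nat.card K : ℚ) ^ m - (Nat.card K : ℚ) ^ (i : ℕ)) := by
    intro M _ _ _ m hm hkm
    subst hm
    rw [card_linearIndependent hkm, Nat.cast_prod, Nat.card_eq_fintype_card]
    refine Finset.prod_congr rfl fun i _ => ?_
    rw [Nat.cast_sub (Nat.pow_le_pow_right hq (i.2.le.trans hkm))]
    push_cast
    rfl
  let e : (Σ X : {X : Submodule K W // finrank K X = k},
      {s : Fin k → X.1 // LinearIndependent K s}) → {s : Fin k → W // LinearIndependent K s} :=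
    fun p => ⟨fun i => (p.2.1 i : W), p.2.2.map' p.1.1.subtype (Submodule.ker_subtype _)⟩
  have hspan : ∀ p, Submodule.span K (Set.range (e p).1) = p.1.1 := by
    rintro ⟨⟨X, hX⟩, s, hs⟩
    refine Submodule.eq_of_le_of_finrank_eq (Submodule.span_le.2 ?_) ?_
    · rintro _ ⟨i, rfl⟩
      exact (s i).2
    · rw [finrank_span_eq_card (e ⟨⟨X, hX⟩, s, hs⟩).2, Fintype.card_fin, hX]
  have he : Function.Bijective e := by
    constructor
    · intro p p' h
      have h1 : p.1 = p'.1 := Subtype.ext (by rw [← hspan p, ← hspan p', h])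
      obtain ⟨X, s, hs⟩ := p
      obtain ⟨X', s', hs'⟩ := p'
      dsimp only at h1
      subst h1
      have : s = s' := by
        funext i
        exact Subtype.ext (congrFun (congrArg Subtype.val h) i)
      subst this
      rfl
    · rintro ⟨s, hs⟩
      refine ⟨⟨⟨Submodule.span K (Set.range s), ?_⟩,
        fun i => ⟨s i, Submodule.subset_span ⟨i, rfl⟩⟩, ?_⟩, rfl⟩
      · rw [finrank_span_eq_card hs, Fintype.card_fin]
      · exact LinearIndependent.of_comp (Submodule.subtype _) hs
  have := Fintype.ofFinite {X : Submodule K W // finrank K X = k}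
  have hcard := Nat.card_congr (Equiv.ofBijective e he)
  rw [Nat.card_sigma] at hcard
  rw [← key hn hk, ← hcard, Nat.cast_sum,
    Finset.sum_congr rfl fun X _ => key X.2 le_rfl, Finset.sum_const, Finset.card_univ,
    Nat.card_eq_fintype_card, nsmul_eq_mul]

end Counting

section Intervals

variable {K W : Type*} [Field K] [AddCommGroup W] [Module K W] [Finite W]

/-- The finite set of all subspaces of vector space dimension `k` between `A` and `B`. -/
noncomputable def subs (A B : Submodule K W) (k : ℕ) : Finset (Submodule K W) :=
  (Set.toFinite {X | A ≤ X ∧ X ≤ B ∧ finrank K X = k}).toFinset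

@[simp]
theorem mem_subs {A B X : Submodule K W} {k : ℕ} :
    X ∈ subs A B k ↔ A ≤ X ∧ X ≤ B ∧ finrank K X = k := by
  simp [subs]

theorem card_subs_eq_card_quotient {A B : Submodule K W} (hAB : A ≤ B) (k : ℕ) :
    (subs A B (finrank K A + k)).card =
      Nat.card {Z : Submodule K (B ⧸ A.submoduleOf B) // finrank K Z = k} := by
  classical
  have hdim : ∀ Y : Submodule K B, A.submoduleOf B ≤ Y →
      finrank K (Y.map (A.submoduleOf B).mkQ) + finrank K A = finrank K Y := by
    intro Y hY
    have h1 := ((A.submoduleOf B).mkQ.domRestrict Y).finrank_range_add_finrank_ker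
    rw [LinearMap.range_domRestrict, LinearMap.ker_domRestrict, Submodule.ker_mkQ] at h1
    rw [← h1, ← (Submodule.submoduleOfEquivOfLe hAB).finrank_eq]
    congr 1
    exact (Submodule.submoduleOfEquivOfLe hY).finrank_eq.symm
  have hcm : ∀ Z : Submodule K (B ⧸ A.submoduleOf B),
      (Z.comap (A.submoduleOf B).mkQ).map (A.submoduleOf B).mkQ = Z := fun Z =>
    Submodule.map_comap_eq_of_surjective (Submodule.mkQ_surjective _) Z
  have hle : ∀ Z : Submodule K (B ⧸ A.submoduleOf B),
      A.submoduleOf B ≤ Z.comap (A.submoduleOf B).mkQ := fun Z =>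
    Submodule.le_comap_mkQ _ _
  have hA : (A.submoduleOf B).map B.subtype = A := by
    rw [Submodule.submoduleOf, Submodule.map_comap_subtype, inf_eq_right.2 hAB]
  rw [← Nat.card_eq_finsetCard]
  symm
  refine Nat.card_congr ?_
  refine Equiv.ofBijective (fun Z => ⟨(Z.1.comap (A.submoduleOf B).mkQ).map B.subtype, ?_⟩) ?_
  · refine mem_subs.2 ⟨?_, Submodule.map_subtype_le _ _, ?_⟩
    · have := Submodule.map_mono (f := B.subtype) (hle Z.1)
      exact hA.symm.le.trans this
    · rw [Submodule.finrank_map_subtype_eq, ← hdim _ (hle _), hcm, Z.2, add_comm]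
  · constructor
    · rintro ⟨Z, hZ⟩ ⟨Z', hZ'⟩ h
      have := Submodule.map_injective_of_injective B.subtype_injective (congrArg Subtype.val h)
      exact Subtype.ext (Submodule.comap_injective_of_surjective (Submodule.mkQ_surjective _) this)
    · rintro ⟨X, hX⟩
      obtain ⟨h1, h2, h3⟩ := mem_subs.1 hX
      have h4 : A.submoduleOf B ≤ X.submoduleOf B := Submodule.comap_mono h1
      refine ⟨⟨(X.submoduleOf B).map (A.submoduleOf B).mkQ, ?_⟩, ?_⟩
      · have := hdim _ h4
        rw [(Submodule.submoduleOfEquivOfLe h2).finrank_eq] at this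
        omega
      · refine Subtype.ext ?_
        dsimp only
        rw [Submodule.comap_map_mkQ, sup_eq_right.2 h4, Submodule.submoduleOf,
          Submodule.map_comap_subtype, inf_eq_right.2 h2]

/-- The number of subspaces of dimension `a + k` between subspaces of dimension `a` and `a + n`
is the Gaussian coefficient `[n choose k]`, here without division. -/
theorem card_subs_mul [Finite K] {A B : Submodule K W} (hAB : A ≤ B) {a n k : ℕ}
    (hA : finrank K A = a) (hB : finrank K B = a + n) (hk : k ≤ n) :
    ((subs A B (a + k)).card : ℚ) *
        ∏ i : Fin k, ((Nat.card K : ℚ) ^ k - (Nat.card K : ℚ) ^ (i : ℕ)) =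
      ∏ i : Fin k, ((Nat.card K : ℚ) ^ n - (Nat.card K : ℚ) ^ (i : ℕ)) := by
  subst hA
  rw [card_subs_eq_card_quotient hAB]
  have : Finite (B ⧸ A.submoduleOf B) := Quotient.finite _
  refine card_finrank_mul ?_ hk
  have := (A.submoduleOf B).finrank_quotient_add_finrank
  rw [(Submodule.submoduleOfEquivOfLe hAB).finrank_eq] at this
  omega

end Intervals

/-! ### Transitivity on pairs of subspaces -/

section Transitivity

variable {K V V' : Type*} [Field K] [AddCommGroup V] [Module K V] [AddCommGroup V'] [Module K V']

/-- Two linear equivalences between complementary subspaces glue. -/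
theorem exists_linearEquiv_extending {A B : Submodule K V} {A' B' : Submodule K V'}
    (h : IsCompl A B) (h' : IsCompl A' B') (eA : A ≃ₗ[K] A') (eB : B ≃ₗ[K] B') :
    ∃ e : V ≃ₗ[K] V', (∀ x : A, e x = eA x) ∧ ∀ x : B, e x = eB x := by
  refine ⟨(A.prodEquivOfIsCompl B h).symm ≪≫ₗ (eA.prodCongr eB) ≪≫ₗ
    (A'.prodEquivOfIsCompl B' h'), fun x => ?_, fun x => ?_⟩ <;> simp

theorem map_eq_of_forall_mem {A C : Submodule K V} {A' C' : Submodule K V'} (e : V ≃ₗ[K] V')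
    (eA : A ≃ₗ[K] A') (he : ∀ x : A, e x = eA x) (hC : C ≤ A) (hC' : C' ≤ A')
    (h : (C.submoduleOf A).map (eA : A →ₗ[K] A') = C'.submoduleOf A') :
    C.map (e : V →ₗ[K] V') = C' := by
  have h1 : C = (C.submoduleOf A).map A.subtype := by
    rw [Submodule.submoduleOf, Submodule.map_comap_subtype, inf_eq_right.2 hC]
  have h2 : C' = (C'.submoduleOf A').map A'.subtype := by
    rw [Submodule.submoduleOf, Submodule.map_comap_subtype, inf_eq_right.2 hC']
  rw [h2, ← h, ← Submodule.map_comp, h1, ← Submodule.map_comp, ← h1]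
  congr 1
  ext x
  simp [he]

variable [FiniteDimensional K V] [FiniteDimensional K V']

/-- Linear equivalences act transitively on the subspaces of a given dimension. -/
theorem exists_linearEquiv_map_eq (hV : finrank K V = finrank K V') {A : Submodule K V}
    {A' : Submodule K V'} (hA : finrank K A = finrank K A') :
    ∃ e : V ≃ₗ[K] V', A.map (e : V →ₗ[K] V') = A' := by
  obtain ⟨B, hB⟩ := A.exists_isCompl
  obtain ⟨B', hB'⟩ := A'.exists_isCompl
  have h1 := Submodule.finrank_add_eq_of_isCompl hB
  have h2 := Submodule.finrank_add_eq_of_isCompl hB'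
  obtain ⟨e, he, -⟩ := exists_linearEquiv_extending hB hB' (LinearEquiv.ofFinrankEq _ _ hA)
    (LinearEquiv.ofFinrankEq _ _ (by omega))
  refine ⟨e, map_eq_of_forall_mem e _ he le_rfl le_rfl ?_⟩
  simp [Submodule.submoduleOf]

/-- There are a complement `A₁` of `A ⊓ B` in `A` and a complement `Q` of `B` containing `A₁`. -/
theorem exists_isCompl_of_le (A B : Submodule K V) : ∃ A₁ Q : Submodule K V, A₁ ≤ Q ∧
    IsCompl B Q ∧ (A ⊓ B) ⊔ A₁ = A ∧ finrank K A₁ + finrank K ↥(A ⊓ B) = finrank K A := by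
  obtain ⟨A₁, hd, hs⟩ := IsModularLattice.exists_disjoint_and_sup_eq (inf_le_left : A ⊓ B ≤ A)
  have hA₁ : A₁ ≤ A := hs ▸ le_sup_right
  have hdB : Disjoint B A₁ := by
    rw [disjoint_iff_inf_le]
    exact le_trans (le_inf (le_inf (inf_le_right.trans hA₁) inf_le_left) inf_le_right) hd.le_bot
  obtain ⟨D, hD⟩ := (B ⊔ A₁).exists_isCompl
  refine ⟨A₁, A₁ ⊔ D, le_sup_left, ⟨?_, ?_⟩, hs, ?_⟩
  · exact hdB.disjoint_sup_right_of_disjoint_sup_left hD.disjoint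
  · rw [codisjoint_iff, ← sup_assoc]
    exact hD.sup_eq_top
  · have := Submodule.finrank_sup_add_finrank_inf_eq (A ⊓ B) A₁
    rw [hs, hd.eq_bot, finrank_bot] at this
    omega

/-- Linear equivalences act transitively on the pairs of subspaces with given dimensions of the two
members and of their intersection. -/
theorem exists_linearEquiv_map_eq_map_eq (hV : finrank K V = finrank K V') {A B : Submodule K V}
    {A' B' : Submodule K V'} (hA : finrank K A = finrank K A') (hB : finrank K B = finrank K B')
    (hAB : finrank K ↥(A ⊓ B) = finrank K ↥(A' ⊓ B')) :
    ∃ e : V ≃ₗ[K] V', A.map (e : V →ₗ[K] V') = A' ∧ B.map (e : V →ₗ[K] V') = B' := by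
  obtain ⟨A₁, Q, h1, h2, h3, h4⟩ := exists_isCompl_of_le A B
  obtain ⟨A₁', Q', h1', h2', h3', h4'⟩ := exists_isCompl_of_le A' B'
  have h5 := Submodule.finrank_add_eq_of_isCompl h2
  have h5' := Submodule.finrank_add_eq_of_isCompl h2'
  obtain ⟨eB, heB⟩ := exists_linearEquiv_map_eq hB (A := (A ⊓ B).submoduleOf B)
    (A' := (A' ⊓ B').submoduleOf B') (by
      rw [(Submodule.submoduleOfEquivOfLe inf_le_right).finrank_eq,
        (Submodule.submoduleOfEquivOfLe inf_le_right).finrank_eq, hAB])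
  obtain ⟨eQ, heQ⟩ := exists_linearEquiv_map_eq (V := Q) (V' := Q') (by omega)
    (A := A₁.submoduleOf Q) (A' := A₁'.submoduleOf Q') (by
      rw [(Submodule.submoduleOfEquivOfLe h1).finrank_eq,
        (Submodule.submoduleOfEquivOfLe h1').finrank_eq]
      omega)
  obtain ⟨e, he1, he2⟩ := exists_linearEquiv_extending h2 h2' eB eQ
  refine ⟨e, ?_, map_eq_of_forall_mem e eB he1 le_rfl le_rfl (by simp [Submodule.submoduleOf])⟩
  rw [← h3, Submodule.map_sup, map_eq_of_forall_mem e eB he1 inf_le_right inf_le_right heB,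
    map_eq_of_forall_mem e eQ he2 h1 h1' heQ, h3']

end Transitivity

/-! ### Averaging over the images of a partial spread -/

section Averaging

variable {K U W : Type*} [Field K] [AddCommGroup U] [Module K U] [Finite U]
  [AddCommGroup W] [Module K W] [Finite W]

/-- The members of `𝓔` that meet `A` in a subspace of vector space dimension `i`. -/
noncomputable def meeting (𝓔 : Finset (Submodule K W)) (A : Submodule K W) (i : ℕ) :
    Finset (Submodule K W) :=
  open Classical in 𝓔.filter fun X => finrank K ↥(A ⊓ X) = i

omit [Finite W] in
theorem mem_meeting {𝓔 : Finset (Submodule K W)} {A X : Submodule K W} {i : ℕ} :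
    X ∈ meeting 𝓔 A i ↔ X ∈ 𝓔 ∧ finrank K ↥(A ⊓ X) = i := by
  classical
  simp [meeting]

theorem finite_linearEquiv : Finite (U ≃ₗ[K] W) :=
  Finite.of_injective (fun e : U ≃ₗ[K] W => (e : U → W)) DFunLike.coe_injective

/-- The linear equivalences `e` with `e τ = π` for which `e σ` lies in `𝓔`. -/
noncomputable def carrying (τ σ : Submodule K U) (π : Submodule K W)
    (𝓔 : Finset (Submodule K W)) : Finset (U ≃ₗ[K] W) :=
  have := finite_linearEquiv (K := K) (U := U) (W := W)
  (Set.toFinite {e : U ≃ₗ[K] W | τ.map (e : U →ₗ[K] W) = π ∧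
    σ.map (e : U →ₗ[K] W) ∈ 𝓔}).toFinset

theorem mem_carrying {τ σ : Submodule K U} {π : Submodule K W} {𝓔 : Finset (Submodule K W)}
    {e : U ≃ₗ[K] W} : e ∈ carrying τ σ π 𝓔 ↔
      τ.map (e : U →ₗ[K] W) = π ∧ σ.map (e : U →ₗ[K] W) ∈ 𝓔 := by
  simp [carrying]

omit [Finite U] [Finite W] in
theorem finrank_map_inf_map (e : U ≃ₗ[K] W) (τ σ : Submodule K U) :
    finrank K ↥(τ.map (e : U →ₗ[K] W) ⊓ σ.map (e : U →ₗ[K] W)) = finrank K ↥(τ ⊓ σ) := by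
  rw [← Submodule.map_inf _ e.injective, LinearEquiv.finrank_map_eq e]

/-- All subspaces in the same position to `π` are images of `σ` equally often. -/
theorem card_carrying_singleton_congr {τ σ : Submodule K U} {π X Y : Submodule K W}
    (hXY : finrank K X = finrank K Y) (h : finrank K ↥(π ⊓ X) = finrank K ↥(π ⊓ Y)) :
    (carrying τ σ π {X}).card = (carrying τ σ π {Y}).card := by
  classical
  have : FiniteDimensional K W := Module.Finite.of_finite
  obtain ⟨h, h1, h2⟩ := exists_linearEquiv_map_eq_map_eq rfl (rfl : finrank K π = _) hXY h
  have h1' : π.map (h.symm : W →ₗ[K] W) = π := by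
    conv_lhs => rw [← h1]
    rw [← Submodule.map_comp]
    simp
  have h2' : Y.map (h.symm : W →ₗ[K] W) = X := by
    rw [← h2, ← Submodule.map_comp]
    simp
  refine Finset.card_bij' (fun e _ => e.trans h) (fun e _ => e.trans h.symm) ?_ ?_ ?_ ?_
  · intro e he
    simp only [mem_carrying, Finset.mem_singleton] at he ⊢
    rw [LinearEquiv.coe_trans, Submodule.map_comp, Submodule.map_comp, he.1, he.2, h1, h2]
    exact ⟨rfl, rfl⟩
  · intro e he
    simp only [mem_carrying, Finset.mem_singleton] at he ⊢
    rw [LinearEquiv.coe_trans, Submodule.map_comp, Submodule.map_comp, he.1, he.2, h1', h2']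
    exact ⟨rfl, rfl⟩
  · intro e _
    ext x
    simp
  · intro e _
    ext x
    simp

theorem card_carrying (τ σ : Submodule K U) (π : Submodule K W) {𝓔 : Finset (Submodule K W)}
    {k c : ℕ} (h𝓔 : ∀ X ∈ 𝓔, finrank K X = k)
    (hc : ∀ X : Submodule K W, finrank K X = k → finrank K ↥(π ⊓ X) = finrank K ↥(τ ⊓ σ) →
      (carrying τ σ π {X}).card = c) :
    (carrying τ σ π 𝓔).card = (meeting 𝓔 π (finrank K ↥(τ ⊓ σ))).card * c := by
  classical
  have hsub : ∀ e ∈ carrying τ σ π 𝓔,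
      σ.map (e : U →ₗ[K] W) ∈ meeting 𝓔 π (finrank K ↥(τ ⊓ σ)) := by
    intro e he
    obtain ⟨h1, h2⟩ := mem_carrying.1 he
    refine mem_meeting.2 ⟨h2, ?_⟩
    rw [← h1, finrank_map_inf_map]
  rw [Finset.card_eq_sum_card_fiberwise hsub, ← smul_eq_mul, ← Finset.sum_const]
  refine Finset.sum_congr rfl fun X hX => ?_
  obtain ⟨h1, h2⟩ := mem_meeting.1 hX
  rw [← hc X (h𝓔 X h1) h2]
  congr 1
  ext e
  simp only [Finset.mem_filter, mem_carrying, Finset.mem_singleton]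
  constructor
  · rintro ⟨⟨h3, -⟩, h4⟩
    exact ⟨h3, h4⟩
  · rintro ⟨h3, h4⟩
    exact ⟨⟨h3, h4 ▸ h1⟩, h4⟩

/-- Among the linear equivalences with `e τ = π`, the proportion of those with `e σ ∈ 𝓔` is the
proportion of members of `𝓔` among the subspaces whose position to `π` is that of `σ` to `τ`. -/
theorem card_carrying_mul (τ σ : Submodule K U) (π : Submodule K W)
    {𝓔 : Finset (Submodule K W)} {k : ℕ} (h𝓔 : ∀ X ∈ 𝓔, finrank K X = k) :
    (meeting (subs ⊥ ⊤ k) π (finrank K ↥(τ ⊓ σ))).card * (carrying τ σ π 𝓔).card =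
      (meeting 𝓔 π (finrank K ↥(τ ⊓ σ))).card * (carrying τ σ π (subs ⊥ ⊤ k)).card := by
  classical
  by_cases hex : ∃ X₀ : Submodule K W, finrank K X₀ = k ∧
      finrank K ↥(π ⊓ X₀) = finrank K ↥(τ ⊓ σ)
  · obtain ⟨X₀, h1, h2⟩ := hex
    have hc : ∀ X : Submodule K W, finrank K X = k →
        finrank K ↥(π ⊓ X) = finrank K ↥(τ ⊓ σ) →
        (carrying τ σ π {X}).card = (carrying τ σ π {X₀}).card := fun X hX hX' =>
      card_carrying_singleton_congr (hX.trans h1.symm) (hX'.trans h2.symm)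
    rw [card_carrying τ σ π h𝓔 hc,
      card_carrying τ σ π (𝓔 := subs ⊥ ⊤ k) (fun X hX => (mem_subs.1 hX).2.2) hc]
    ring
  · have : ∀ 𝓕 : Finset (Submodule K W), (∀ X ∈ 𝓕, finrank K X = k) →
        meeting 𝓕 π (finrank K ↥(τ ⊓ σ)) = ∅ := by
      intro 𝓕 h𝓕
      refine Finset.eq_empty_of_forall_notMem fun X hX => hex ⟨X, h𝓕 X (mem_meeting.1 hX).1, ?_⟩
      exact (mem_meeting.1 hX).2
    rw [this 𝓔 h𝓔, this _ fun X hX => (mem_subs.1 hX).2.2]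
    simp

section Spread

variable {ι : Type*} [Fintype ι] {k : ℕ} {σ : ι → Submodule K U} {𝓔 : Finset (Submodule K W)}

/-- An image of the partial spread `σ` contains at most one member of a set `𝓔` of pairwise
intersecting subspaces. Averaging over all images bounds the size of `𝓔`, and if the bound is
attained, then every image contains exactly one member of `𝓔`. -/
theorem card_mul_card_le_and_forall [Nonempty ι] (hUW : finrank K U = finrank K W)
    (hσ : ∀ j, finrank K (σ j) = k) (hd : Pairwise fun i j => σ i ⊓ σ j = ⊥)
    (h𝓔 : ∀ X ∈ 𝓔, finrank K X = k) (hint : ∀ X ∈ 𝓔, ∀ Y ∈ 𝓔, X ⊓ Y ≠ ⊥) :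
    Fintype.card ι * 𝓔.card ≤ (subs (⊥ : Submodule K W) ⊤ k).card ∧
    (Fintype.card ι * 𝓔.card = (subs (⊥ : Submodule K W) ⊤ k).card →
      ∀ e : U ≃ₗ[K] W, ∃! j, (σ j).map (e : U →ₗ[K] W) ∈ 𝓔) := by
  classical
  have : FiniteDimensional K W := Module.Finite.of_finite
  have : FiniteDimensional K U := Module.Finite.of_finite
  have := finite_linearEquiv (K := K) (U := U) (W := W)
  let _ := Fintype.ofFinite (U ≃ₗ[K] W)
  have : Nonempty (U ≃ₗ[K] W) := ⟨LinearEquiv.ofFinrankEq _ _ hUW⟩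
  -- For `τ = ⊥` and `π = ⊥`, the position to `π` is no condition.
  have huniv : ∀ j, carrying ⊥ (σ j) (⊥ : Submodule K W) (subs ⊥ ⊤ k) = Finset.univ := by
    intro j
    refine Finset.eq_univ_of_forall fun e => mem_carrying.2 ⟨Submodule.map_bot _, ?_⟩
    exact mem_subs.2 ⟨bot_le, le_top, (LinearEquiv.finrank_map_eq e _).trans (hσ j)⟩
  have hmeet : ∀ 𝓕 : Finset (Submodule K W), meeting 𝓕 ⊥ 0 = 𝓕 := by
    intro 𝓕
    ext X
    simp [mem_meeting]
  have hprop : ∀ j, (subs (⊥ : Submodule K W) ⊤ k).card *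
      (Finset.univ.filter fun e : U ≃ₗ[K] W => (σ j).map (e : U →ₗ[K] W) ∈ 𝓔).card =
        𝓔.card * Fintype.card (U ≃ₗ[K] W) := by
    intro j
    have := card_carrying_mul ⊥ (σ j) (⊥ : Submodule K W) h𝓔
    rw [huniv, bot_inf_eq, finrank_bot, hmeet, hmeet, Finset.card_univ] at this
    rw [← this]
    congr 2
    ext e
    simp [mem_carrying]
  let cnt : (U ≃ₗ[K] W) → ℕ := fun e =>
    (Finset.univ.filter fun j => (σ j).map (e : U →ₗ[K] W) ∈ 𝓔).card
  have hcnt : ∀ e ∈ Finset.univ, cnt e ≤ 1 := by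
    intro e _
    refine Finset.card_le_one.2 fun i hi j hj => ?_
    by_contra hij
    simp only [Finset.mem_filter, Finset.mem_univ, true_and] at hi hj
    refine hint _ hi _ hj ?_
    rw [← Submodule.map_inf _ e.injective, hd hij, Submodule.map_bot]
  have hsum : (subs (⊥ : Submodule K W) ⊤ k).card * ∑ e, cnt e =
      (Fintype.card ι * 𝓔.card) * Fintype.card (U ≃ₗ[K] W) := by
    have : ∑ e, cnt e = ∑ j, (Finset.univ.filter fun e : U ≃ₗ[K] W =>
        (σ j).map (e : U →ₗ[K] W) ∈ 𝓔).card := by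
      simp only [cnt, Finset.card_filter]
      exact Finset.sum_comm
    rw [this, Finset.mul_sum, Finset.sum_congr rfl fun j _ => hprop j, Finset.sum_const,
      Finset.card_univ, smul_eq_mul]
    ring
  have hpos : 0 < Fintype.card (U ≃ₗ[K] W) := Fintype.card_pos
  have hle : ∑ e, cnt e ≤ Fintype.card (U ≃ₗ[K] W) := by
    refine (Finset.sum_le_sum hcnt).trans ?_
    simp
  refine ⟨?_, fun heq e => ?_⟩
  · refine Nat.le_of_mul_le_mul_right ?_ hpos
    rw [← hsum]
    exact Nat.mul_le_mul_left _ hle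
  · obtain ⟨j₀⟩ := ‹Nonempty ι›
    have hN : 0 < (subs (⊥ : Submodule K W) ⊤ k).card := Finset.card_pos.2
      ⟨_, mem_subs.2 ⟨bot_le, le_top, (LinearEquiv.finrank_map_eq e (σ j₀)).trans (hσ j₀)⟩⟩
    rw [heq] at hsum
    have hall := (Finset.sum_eq_sum_iff_of_le hcnt).1
      (by rw [Nat.eq_of_mul_eq_mul_left hN hsum]; simp) e (Finset.mem_univ e)
    obtain ⟨j, hj⟩ := Finset.card_eq_one.1 hall
    have hmem : ∀ i, (σ i).map (e : U →ₗ[K] W) ∈ 𝓔 ↔ i = j := by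
      intro i
      rw [← Finset.mem_singleton, ← hj]
      simp
    exact ⟨j, (hmem j).2 rfl, fun i hi => (hmem i).1 hi⟩

/-- If every image of the partial spread `σ` has exactly one member in `𝓔`, then averaging over the
images for which `τ` is mapped to `π` gives a linear relation between the numbers of members of
`𝓔` in the different positions to `π`. -/
theorem sum_card_meeting_div_eq_one (hUW : finrank K U = finrank K W)
    (hσ : ∀ j, finrank K (σ j) = k) (h𝓔 : ∀ X ∈ 𝓔, finrank K X = k)
    (h : ∀ e : U ≃ₗ[K] W, ∃! j, (σ j).map (e : U →ₗ[K] W) ∈ 𝓔)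
    {τ : Submodule K U} {π : Submodule K W} (hτ : finrank K τ = finrank K π) :
    ∑ j, ((meeting 𝓔 π (finrank K ↥(τ ⊓ σ j))).card : ℚ) /
      (meeting (subs ⊥ ⊤ k) π (finrank K ↥(τ ⊓ σ j))).card = 1 := by
  classical
  have : FiniteDimensional K W := Module.Finite.of_finite
  have : FiniteDimensional K U := Module.Finite.of_finite
  obtain ⟨e₀, he₀⟩ := exists_linearEquiv_map_eq hUW hτ
  have hall : ∀ (e : U ≃ₗ[K] W) j, (σ j).map (e : U →ₗ[K] W) ∈ subs (⊥ : Submodule K W) ⊤ k :=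
    fun e j => mem_subs.2 ⟨bot_le, le_top, (LinearEquiv.finrank_map_eq e (σ j)).trans (hσ j)⟩
  have hM : ∀ j, carrying τ (σ j) π (subs ⊥ ⊤ k) = carrying τ ⊤ π {⊤} := by
    intro j
    ext e
    have := hall e j
    simp only [mem_carrying, this, and_true, Finset.mem_singleton]
    refine ⟨fun h => ⟨h, ?_⟩, fun h => h.1⟩
    rw [Submodule.map_top, LinearEquiv.range]
  have hMpos : 0 < (carrying τ ⊤ π {⊤}).card := Finset.card_pos.2 ⟨e₀, mem_carrying.2
    ⟨he₀, by rw [Submodule.map_top, LinearEquiv.range]; exact Finset.mem_singleton_self _⟩⟩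
  have hterm : ∀ j, ((meeting 𝓔 π (finrank K ↥(τ ⊓ σ j))).card : ℚ) /
      (meeting (subs ⊥ ⊤ k) π (finrank K ↥(τ ⊓ σ j))).card =
        (carrying τ (σ j) π 𝓔).card / (carrying τ ⊤ π {⊤}).card := by
    intro j
    have h1 := card_carrying_mul τ (σ j) π h𝓔
    rw [hM] at h1
    have h2 : 0 < (meeting (subs ⊥ ⊤ k) π (finrank K ↥(τ ⊓ σ j))).card := by
      refine Finset.card_pos.2 ⟨(σ j).map (e₀ : U →ₗ[K] W), mem_meeting.2 ⟨hall e₀ j, ?_⟩⟩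
      conv_lhs => rw [← he₀]
      exact finrank_map_inf_map e₀ τ (σ j)
    rw [div_eq_div_iff (by positivity) (by positivity), mul_comm ((carrying τ (σ j) π 𝓔).card : ℚ)]
    exact_mod_cast h1.symm
  rw [Finset.sum_congr rfl fun j _ => hterm j, ← Finset.sum_div, div_eq_one_iff_eq
    (by positivity)]
  norm_cast
  -- every equivalence is counted for exactly one index
  rw [← Finset.card_biUnion]
  · congr 1
    ext e
    simp only [Finset.mem_biUnion, Finset.mem_univ, true_and, mem_carrying,
      Finset.mem_singleton, Submodule.map_top, LinearEquiv.range, and_true]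
    constructor
    · rintro ⟨j, h1, -⟩
      exact h1
    · intro h1
      obtain ⟨j, hj, -⟩ := h e
      exact ⟨j, h1, hj⟩
  · intro i _ j _ hij
    refine Finset.disjoint_left.2 fun e h1 h2 => hij ?_
    exact (h e).unique (mem_carrying.1 h1).2 (mem_carrying.1 h2).2

end Spread

end Averaging

/-! ### The Desarguesian spread of planes -/

section DesarguesianSpread

variable {K L : Type*} [Field K] [Field L] [Algebra K L] [FiniteDimensional K L]

/-- The Desarguesian spread of `L × L`: the one-dimensional `L`-subspaces, viewed as subspaces over
`K`. The index `none` stands for `L × 0` and `some b` for the span of `(b, 1)`. -/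
def desarguesianSpread (K L : Type*) [Field K] [Field L] [Algebra K L] :
    Option L → Submodule K (L × L)
  | none => Submodule.prod ⊤ ⊥
  | some b => LinearMap.range ((LinearMap.mulLeft K b).prod LinearMap.id)

omit [FiniteDimensional K L] in
theorem mem_desarguesianSpread_none {x : L × L} :
    x ∈ desarguesianSpread K L none ↔ x.2 = 0 := by
  simp [desarguesianSpread, Submodule.mem_prod]

omit [FiniteDimensional K L] in
theorem mem_desarguesianSpread_some {b : L} {x : L × L} :
    x ∈ desarguesianSpread K L (some b) ↔ x.1 = b * x.2 := by
  constructor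
  · rintro ⟨y, rfl⟩
    simp
  · intro h
    exact ⟨x.2, Prod.ext h.symm rfl⟩

omit [FiniteDimensional K L] in
theorem desarguesianSpread_pairwise :
    Pairwise fun i j => desarguesianSpread K L i ⊓ desarguesianSpread K L j = ⊥ := by
  intro i j hij
  rw [Submodule.eq_bot_iff]
  rintro ⟨x, y⟩ ⟨h1, h2⟩
  rcases i with _ | a <;> rcases j with _ | b
  · exact absurd rfl hij
  · rw [SetLike.mem_coe, mem_desarguesianSpread_none] at h1
    rw [SetLike.mem_coe, mem_desarguesianSpread_some] at h2
    dsimp only at h1 h2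
    simp [h1, h2]
  · rw [SetLike.mem_coe, mem_desarguesianSpread_none] at h2
    rw [SetLike.mem_coe, mem_desarguesianSpread_some] at h1
    dsimp only at h1 h2
    simp [h1, h2]
  · rw [SetLike.mem_coe, mem_desarguesianSpread_some] at h1 h2
    dsimp only at h1 h2
    have hab : a ≠ b := fun h => hij (congrArg some h)
    have : (a - b) * y = 0 := by rw [sub_mul, ← h1, ← h2, sub_self]
    have hy := (mul_eq_zero.1 this).resolve_left (sub_ne_zero.2 hab)
    simp [h1, hy]

theorem finrank_submodule_prod (A B : Submodule K L) :
    finrank K ↥(A.prod B) = finrank K A + finrank K B := by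
  have h : A.prod B = LinearMap.range (A.subtype.prodMap B.subtype) := by
    rw [LinearMap.range_prodMap, A.range_subtype, B.range_subtype]
  rw [h, ← finrank_prod, LinearMap.finrank_range_of_inj
    (Function.Injective.prodMap A.subtype_injective B.subtype_injective)]

theorem finrank_desarguesianSpread (i : Option L) :
    finrank K (desarguesianSpread K L i) = finrank K L := by
  rcases i with _ | b
  · rw [desarguesianSpread, finrank_submodule_prod, finrank_top, finrank_bot, add_zero]
  · rw [desarguesianSpread, LinearMap.finrank_range_of_inj]
    intro x y h
    exact congrArg Prod.snd h

/-- A subspace `A × K` meets the spread element `L × 0` in `A × 0`, the one spanned by `(b, 1)` with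
`b ∈ A` in a one-dimensional subspace, and the others trivially. -/
theorem finrank_inf_desarguesianSpread (A : Submodule K L) [DecidablePred (· ∈ A)]
    (i : Option L) :
    finrank K ↥(A.prod (Submodule.span K {1}) ⊓ desarguesianSpread K L i) =
      i.elim (finrank K A) fun b => if b ∈ A then 1 else 0 := by
  rcases i with _ | b
  · rw [desarguesianSpread, Submodule.prod_inf_prod, inf_top_eq, inf_bot_eq,
      finrank_submodule_prod, finrank_bot, add_zero]
    rfl
  · simp only [Option.elim_some]
    have hmem : ∀ x : L × L, x ∈ A.prod (Submodule.span K {1}) ⊓ desarguesianSpread K L (some b) ↔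
        ∃ c : K, x = c • (b, 1) ∧ c • b ∈ A := by
      intro x
      rw [Submodule.mem_inf, mem_desarguesianSpread_some, Submodule.mem_prod,
        Submodule.mem_span_singleton]
      constructor
      · rintro ⟨⟨h1, c, hc⟩, h2⟩
        have h3 : x.1 = c • b := by rw [h2, ← hc, mul_smul_comm, mul_one]
        exact ⟨c, Prod.ext (by simpa using h3) (by simpa using hc.symm), h3 ▸ h1⟩
      · rintro ⟨c, rfl, h⟩
        exact ⟨⟨h, c, rfl⟩, by simp⟩
    split_ifs with hb
    · have hspan : A.prod (Submodule.span K {1}) ⊓ desarguesianSpread K L (some b) =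
          Submodule.span K {((b, 1) : L × L)} := by
        ext x
        rw [hmem, Submodule.mem_span_singleton]
        exact ⟨fun ⟨c, h, _⟩ => ⟨c, h.symm⟩, fun ⟨c, h⟩ => ⟨c, h.symm, A.smul_mem c hb⟩⟩
      rw [hspan, finrank_span_singleton (by simp)]
    · rw [Submodule.finrank_eq_zero, Submodule.eq_bot_iff]
      intro x hx
      obtain ⟨c, rfl, h⟩ := (hmem x).1 hx
      by_cases hc : c = 0
      · simp [hc]
      · exact absurd ((A.smul_mem_iff hc).1 h) hb

end DesarguesianSpread

/-- A finite field has an extension of degree three. -/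
theorem exists_cubic_extension (K : Type*) [Field K] [Finite K] :
    ∃ (L : Type) (_ : Field L) (_ : Algebra K L), Finite L ∧ finrank K L = 3 := by
  obtain ⟨p, hp⟩ := CharP.exists K
  have : Fact p.Prime := ⟨CharP.char_is_prime K p⟩
  exact ⟨FiniteField.Extension K p 3, inferInstance, inferInstance, inferInstance,
    FiniteField.finrank_extension K p 3⟩

section SpreadRelations

variable {K W : Type*} [Field K] [Finite K] [AddCommGroup W] [Module K W] [Finite W]
  {𝓔 : Finset (Submodule K W)}

/-- The proportion of members of `𝓔` among the planes that meet `π` in dimension `i`. -/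
noncomputable def meetingRatio (𝓔 : Finset (Submodule K W)) (π : Submodule K W) (i : ℕ) : ℚ :=
  ((meeting 𝓔 π i).card : ℚ) / (meeting (subs ⊥ ⊤ 3) π i).card

/-- A set of pairwise intersecting planes contains at most one plane of each image of the
Desarguesian spread. This gives the upper bound on its size, and in the case of equality two linear
relations for the numbers of its members in the different positions to a given plane. -/
theorem spread_bound_and_relations (hW : finrank K W = 6) (h𝓔 : ∀ X ∈ 𝓔, finrank K X = 3)
    (hint : ∀ X ∈ 𝓔, ∀ Y ∈ 𝓔, X ⊓ Y ≠ ⊥) :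
    (Nat.card K ^ 3 + 1) * 𝓔.card ≤ (subs (⊥ : Submodule K W) ⊤ 3).card ∧
    ((Nat.card K ^ 3 + 1) * 𝓔.card = (subs (⊥ : Submodule K W) ⊤ 3).card →
      ∀ π : Submodule K W, finrank K π = 3 →
        meetingRatio 𝓔 π 3 + (Nat.card K : ℚ) ^ 3 * meetingRatio 𝓔 π 0 = 1 ∧
        meetingRatio 𝓔 π 2 + (Nat.card K : ℚ) ^ 2 * meetingRatio 𝓔 π 1 +
          ((Nat.card K : ℚ) ^ 3 - (Nat.card K : ℚ) ^ 2) * meetingRatio 𝓔 π 0 = 1) := by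
  classical
  obtain ⟨L, _, _, _, hL⟩ := exists_cubic_extension K
  have : FiniteDimensional K L := Module.Finite.of_finite
  let _ := Fintype.ofFinite L
  have hUW : finrank K (L × L) = finrank K W := by rw [finrank_prod, hL, hW]
  have hσ : ∀ j, finrank K (desarguesianSpread K L j) = 3 := fun j =>
    (finrank_desarguesianSpread j).trans hL
  have hLcard : Fintype.card L = Nat.card K ^ 3 := by
    rw [← Nat.card_eq_fintype_card, Module.natCard_eq_pow_finrank (K := K), hL]
  have hcard : Fintype.card (Option L) = Nat.card K ^ 3 + 1 := by
    rw [Fintype.card_option, hLcard]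
  obtain ⟨h1, h2⟩ := card_mul_card_le_and_forall hUW hσ desarguesianSpread_pairwise h𝓔 hint
  rw [hcard] at h1 h2
  refine ⟨h1, fun heq π hπ => ?_⟩
  have h3 := fun (τ : Submodule K (L × L)) (hτ : finrank K τ = 3) =>
    sum_card_meeting_div_eq_one hUW hσ h𝓔 (h2 heq) (hτ.trans hπ.symm)
  change ∀ τ : Submodule K (L × L), finrank K τ = 3 →
    ∑ j, meetingRatio 𝓔 π (finrank K ↥(τ ⊓ desarguesianSpread K L j)) = 1 at h3
  constructor
  · have h4 := h3 (desarguesianSpread K L none) (hσ none)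
    rw [Fintype.sum_option, inf_idem, hσ, Finset.sum_congr rfl fun b _ => by
      rw [desarguesianSpread_pairwise (Option.some_ne_none b).symm, finrank_bot],
      Finset.sum_const, Finset.card_univ, hLcard, nsmul_eq_mul] at h4
    exact_mod_cast h4
  · obtain ⟨f, hf⟩ := exists_linearIndependent_of_le_finrank (R := K) (M := L) (n := 2)
      (by omega)
    have hA : finrank K (Submodule.span K (Set.range f)) = 2 := by
      rw [finrank_span_eq_card hf, Fintype.card_fin]
    set A := Submodule.span K (Set.range f)
    have h4 := h3 (A.prod (Submodule.span K {1})) (by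
      rw [finrank_submodule_prod, hA, finrank_span_singleton one_ne_zero])
    have hcA : (Finset.univ.filter fun b : L => b ∈ A).card = Nat.card K ^ 2 := by
      rw [← hA, ← Module.natCard_eq_pow_finrank, Nat.card_eq_fintype_card, Fintype.card_subtype]
    have hcA' : ((Finset.univ.filter fun b : L => b ∉ A).card : ℚ) =
        (Nat.card K : ℚ) ^ 3 - (Nat.card K : ℚ) ^ 2 := by
      have := Finset.card_filter_add_card_filter_not (s := (Finset.univ : Finset L)) (· ∈ A)
      rw [hcA, Finset.card_univ, hLcard] at this
      rw [eq_sub_iff_add_eq, add_comm]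
      exact_mod_cast this
    simp only [finrank_inf_desarguesianSpread, Fintype.sum_option, Option.elim_none,
      Option.elim_some, hA] at h4
    rw [← h4, ← Finset.sum_filter_add_sum_filter_not Finset.univ (· ∈ A), add_assoc]
    congr 2
    · rw [Finset.sum_congr rfl fun b hb => by rw [if_pos (Finset.mem_filter.1 hb).2],
        Finset.sum_const, hcA, nsmul_eq_mul]
      push_cast
      rfl
    · rw [Finset.sum_congr rfl fun b hb => by rw [if_neg (Finset.mem_filter.1 hb).2],
        Finset.sum_const, nsmul_eq_mul, hcA']

end SpreadRelations

/-! ### Values of Gaussian coefficients -/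

section GaussianValues

variable {K W : Type*} [Field K] [Finite K] [AddCommGroup W] [Module K W]

theorem one_lt_natCard_cast : (1 : ℚ) < Nat.card K := by
  exact_mod_cast Finite.one_lt_card (α := K)

variable [Finite W] {A B : Submodule K W}

omit [Finite K] in
theorem card_subs_bottom (hAB : A ≤ B) {a : ℕ} (hA : finrank K A = a) :
    (subs A B a).card = 1 := by
  rw [Finset.card_eq_one]
  have : FiniteDimensional K W := Module.Finite.of_finite
  refine ⟨A, ?_⟩
  ext X
  rw [mem_subs, Finset.mem_singleton]
  constructor
  · rintro ⟨h1, -, h3⟩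
    exact (Submodule.eq_of_le_of_finrank_eq h1 (hA.trans h3.symm)).symm
  · rintro rfl
    exact ⟨le_rfl, hAB, hA⟩

/-- The number of subspaces covering `A` below `B`. -/
theorem card_subs_covering (hAB : A ≤ B) {a : ℕ} (n : ℕ) (hA : finrank K A = a)
    (hB : finrank K B = a + n) :
    ((subs A B (a + 1)).card : ℚ) = ∑ i ∈ Finset.range n, (Nat.card K : ℚ) ^ i := by
  have hq := one_lt_natCard_cast (K := K)
  rcases Nat.eq_zero_or_pos n with rfl | hn
  · rw [Finset.range_zero, Finset.sum_empty, Nat.cast_eq_zero, Finset.card_eq_zero]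
    refine Finset.eq_empty_of_forall_notMem fun X hX => ?_
    obtain ⟨-, h2, h3⟩ := mem_subs.1 hX
    have : FiniteDimensional K W := Module.Finite.of_finite
    have := Submodule.finrank_mono h2
    omega
  · have h := card_subs_mul hAB hA hB hn
    simp only [Fin.prod_univ_one, pow_one, Fin.val_zero, pow_zero] at h
    rw [geom_sum_eq hq.ne', eq_div_iff (by linarith)]
    exact h

theorem card_points {n : ℕ} (hB : finrank K B = n) :
    ((subs ⊥ B 1).card : ℚ) = ∑ i ∈ Finset.range n, (Nat.card K : ℚ) ^ i :=
  card_subs_covering bot_le n (finrank_bot K W) (by rw [hB, zero_add])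

/-- The number of subspaces of `B` of codimension one that contain `A`, for `A` of codimension
three. -/
theorem card_subs_codim_three (hAB : A ≤ B) {a : ℕ} (hA : finrank K A = a)
    (hB : finrank K B = a + 3) :
    ((subs A B (a + 2)).card : ℚ) = (Nat.card K : ℚ) ^ 2 + Nat.card K + 1 := by
  have hq := one_lt_natCard_cast (K := K)
  have h := card_subs_mul hAB hA hB (show 2 ≤ 3 by norm_num)
  simp only [Fin.prod_univ_two, Fin.val_zero, Fin.val_one, pow_zero, pow_one] at h
  generalize (Nat.card K : ℚ) = q at *
  have h1 : (q ^ 2 - 1) * (q ^ 2 - q) ≠ 0 :=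
    mul_ne_zero (by nlinarith) (by nlinarith)
  refine mul_right_cancel₀ h1 (h.trans ?_)
  ring

theorem card_subs_codim_four (hAB : A ≤ B) {a : ℕ} (hA : finrank K A = a)
    (hB : finrank K B = a + 4) :
    ((subs A B (a + 3)).card : ℚ) =
      (Nat.card K : ℚ) ^ 3 + (Nat.card K : ℚ) ^ 2 + Nat.card K + 1 := by
  have hq := one_lt_natCard_cast (K := K)
  have h := card_subs_mul hAB hA hB (show 3 ≤ 4 by norm_num)
  simp only [Fin.prod_univ_three, Fin.val_zero, Fin.val_one, Fin.val_two, pow_zero, pow_one] at h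
  generalize (Nat.card K : ℚ) = q at *
  have h1 : (q ^ 3 - 1) * (q ^ 3 - q) * (q ^ 3 - q ^ 2) ≠ 0 := by
    have h2 : q ^ 3 - 1 = (q - 1) * (q ^ 2 + q + 1) := by ring
    have h3 : q ^ 3 - q = q * ((q - 1) * (q + 1)) := by ring
    have h4 : q ^ 3 - q ^ 2 = q ^ 2 * (q - 1) := by ring
    have : 0 < q - 1 := by linarith
    have : 0 < q := by linarith
    rw [h2, h3, h4]
    positivity
  refine mul_right_cancel₀ h1 (h.trans ?_)
  ring

theorem card_subs_five_two (hAB : A ≤ B) {a : ℕ} (hA : finrank K A = a)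
    (hB : finrank K B = a + 5) :
    ((subs A B (a + 2)).card : ℚ) = (Nat.card K : ℚ) ^ 6 + (Nat.card K : ℚ) ^ 5 +
      2 * (Nat.card K : ℚ) ^ 4 + 2 * (Nat.card K : ℚ) ^ 3 + 2 * (Nat.card K : ℚ) ^ 2 +
      Nat.card K + 1 := by
  have hq := one_lt_natCard_cast (K := K)
  have h := card_subs_mul hAB hA hB (show 2 ≤ 5 by norm_num)
  simp only [Fin.prod_univ_two, Fin.val_zero, Fin.val_one, pow_zero, pow_one] at h
  generalize (Nat.card K : ℚ) = q at *
  have h1 : (q ^ 2 - 1) * (q ^ 2 - q) ≠ 0 :=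
    mul_ne_zero (by nlinarith) (by nlinarith)
  refine mul_right_cancel₀ h1 (h.trans ?_)
  ring

theorem card_subs_six_four (hAB : A ≤ B) {a : ℕ} (hA : finrank K A = a)
    (hB : finrank K B = a + 6) :
    ((subs A B (a + 4)).card : ℚ) = ((Nat.card K : ℚ) ^ 4 + (Nat.card K : ℚ) ^ 2 + 1) *
      ((Nat.card K : ℚ) ^ 4 + (Nat.card K : ℚ) ^ 3 + (Nat.card K : ℚ) ^ 2 + Nat.card K + 1) := by
  have hq := one_lt_natCard_cast (K := K)
  have h := card_subs_mul hAB hA hB (show 4 ≤ 6 by norm_num)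
  simp only [Fin.prod_univ_succ, Fin.prod_univ_zero, Fin.val_zero, Fin.val_succ, pow_zero, pow_one,
    zero_add, mul_one, Nat.reduceAdd] at h
  generalize (Nat.card K : ℚ) = q at *
  have h1 : (q ^ 4 - 1) * ((q ^ 4 - q) * ((q ^ 4 - q ^ 2) * (q ^ 4 - q ^ 3))) ≠ 0 := by
    have h2 : q ^ 4 - 1 = (q - 1) * (q ^ 3 + q ^ 2 + q + 1) := by ring
    have h3 : q ^ 4 - q = q * ((q - 1) * (q ^ 2 + q + 1)) := by ring
    have h4 : q ^ 4 - q ^ 2 = q ^ 2 * ((q - 1) * (q + 1)) := by ring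
    have h5 : q ^ 4 - q ^ 3 = q ^ 3 * (q - 1) := by ring
    have : 0 < q - 1 := by linarith
    have : 0 < q := by linarith
    rw [h2, h3, h4, h5]
    positivity
  refine mul_right_cancel₀ h1 (h.trans ?_)
  ring

theorem card_subs_six_three (hAB : A ≤ B) {a : ℕ} (hA : finrank K A = a)
    (hB : finrank K B = a + 6) :
    ((subs A B (a + 3)).card : ℚ) = ((Nat.card K : ℚ) ^ 3 + 1) * ((Nat.card K : ℚ) ^ 6 +
      (Nat.card K : ℚ) ^ 5 + 2 * (Nat.card K : ℚ) ^ 4 + 2 * (Nat.card K : ℚ) ^ 3 +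
      2 * (Nat.card K : ℚ) ^ 2 + Nat.card K + 1) := by
  have hq := one_lt_natCard_cast (K := K)
  have h := card_subs_mul hAB hA hB (show 3 ≤ 6 by norm_num)
  simp only [Fin.prod_univ_three, Fin.val_zero, Fin.val_one, Fin.val_two, pow_zero, pow_one] at h
  generalize (Nat.card K : ℚ) = q at *
  have h1 : (q ^ 3 - 1) * (q ^ 3 - q) * (q ^ 3 - q ^ 2) ≠ 0 := by
    have h2 : q ^ 3 - 1 = (q - 1) * (q ^ 2 + q + 1) := by ring
    have h3 : q ^ 3 - q = q * ((q - 1) * (q + 1)) := by ring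
    have h4 : q ^ 3 - q ^ 2 = q ^ 2 * (q - 1) := by ring
    have : 0 < q - 1 := by linarith
    have : 0 < q := by linarith
    rw [h2, h3, h4]
    positivity
  refine mul_right_cancel₀ h1 (h.trans ?_)
  ring

end GaussianValues

/-! ### Degrees and positions to a plane -/

section Degrees

variable {K W : Type*} [Field K] [AddCommGroup W] [Module K W] [Finite W]

/-- The number of members of `𝓔` that contain `A`. -/
noncomputable def deg (𝓔 : Finset (Submodule K W)) (A : Submodule K W) : ℕ :=
  open Classical in (𝓔.filter fun X => A ≤ X).card

theorem deg_subs (A : Submodule K W) (k : ℕ) : deg (subs ⊥ ⊤ k) A = (subs A ⊤ k).card := by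
  rw [deg]
  congr 1
  ext X
  simp only [Finset.mem_filter, mem_subs, bot_le, le_top, true_and]
  exact and_comm

theorem sum_deg (𝓔 : Finset (Submodule K W)) (B : Submodule K W) (j : ℕ) :
    ∑ A ∈ subs ⊥ B j, (deg 𝓔 A : ℚ) = ∑ X ∈ 𝓔, ((subs ⊥ (B ⊓ X) j).card : ℚ) := by
  classical
  have h := Finset.sum_card_bipartiteAbove_eq_sum_card_bipartiteBelow
    (s := subs ⊥ B j) (t := 𝓔) (fun A X => A ≤ X)
  have h2 : ∀ X, Finset.bipartiteBelow (fun A X => A ≤ X) (subs ⊥ B j) X =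
      subs ⊥ (B ⊓ X) j := by
    intro X
    ext A
    simp only [Finset.mem_bipartiteBelow, mem_subs, bot_le, true_and, le_inf_iff]
    tauto
  simp only [h2] at h
  rw [← Nat.cast_sum, ← Nat.cast_sum, ← h]
  rfl

variable {𝓔 : Finset (Submodule K W)} {π : Submodule K W}

theorem sum_finrank_inf (φ : ℕ → ℚ) (hπ : finrank K π = 3) :
    ∑ X ∈ 𝓔, φ (finrank K ↥(π ⊓ X)) = (meeting 𝓔 π 0).card * φ 0 +
      (meeting 𝓔 π 1).card * φ 1 + (meeting 𝓔 π 2).card * φ 2 + (meeting 𝓔 π 3).card * φ 3 := by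
  classical
  have : FiniteDimensional K W := Module.Finite.of_finite
  have hmap : ∀ X ∈ 𝓔, finrank K ↥(π ⊓ X) ∈ Finset.range 4 := by
    intro X _
    rw [Finset.mem_range, Nat.lt_succ_iff, ← hπ]
    exact Submodule.finrank_mono inf_le_left
  rw [← Finset.sum_fiberwise_of_maps_to hmap]
  have : ∀ i, ∑ X ∈ 𝓔 with finrank K ↥(π ⊓ X) = i, φ (finrank K ↥(π ⊓ X)) =
      (meeting 𝓔 π i).card * φ i := by
    intro i
    rw [Finset.sum_congr rfl fun X hX => by rw [(Finset.mem_filter.1 hX).2], Finset.sum_const,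
      nsmul_eq_mul, meeting]
  simp only [this, Finset.sum_range_succ, Finset.sum_range_zero, zero_add]

theorem card_meeting_three (hπ : finrank K π = 3) (h𝓔 : ∀ X ∈ 𝓔, finrank K X = 3)
    [Decidable (π ∈ 𝓔)] : (meeting 𝓔 π 3).card = if π ∈ 𝓔 then 1 else 0 := by
  have : FiniteDimensional K W := Module.Finite.of_finite
  have h : ∀ X, X ∈ meeting 𝓔 π 3 ↔ X ∈ 𝓔 ∧ X = π := by
    intro X
    rw [mem_meeting]
    refine and_congr_right fun hX => ⟨fun h => ?_, ?_⟩
    · rw [← Submodule.eq_of_le_of_finrank_eq inf_le_right (h.trans (h𝓔 X hX).symm)]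
      exact Submodule.eq_of_le_of_finrank_eq inf_le_left (h.trans hπ.symm)
    · rintro rfl
      rwa [inf_idem]
  split_ifs with hmem
  · refine Finset.card_eq_one.2 ⟨π, ?_⟩
    ext X
    rw [h, Finset.mem_singleton]
    exact ⟨fun h => h.2, fun h => ⟨h ▸ hmem, h⟩⟩
  · refine Finset.card_eq_zero.2 (Finset.eq_empty_of_forall_notMem fun X hX => ?_)
    obtain ⟨h1, rfl⟩ := (h X).1 hX
    exact hmem h1

variable [Finite K]

/-- The three double counts relating the numbers of members of `𝓔` in the different positions to
the plane `π` with the size of `𝓔` and the degrees of the points and lines of `π`. -/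
theorem double_counts (hπ : finrank K π = 3) :
    (𝓔.card : ℚ) = (meeting 𝓔 π 0).card + (meeting 𝓔 π 1).card + (meeting 𝓔 π 2).card +
      (meeting 𝓔 π 3).card ∧
    ∑ P ∈ subs ⊥ π 1, (deg 𝓔 P : ℚ) = (meeting 𝓔 π 1).card +
      (Nat.card K + 1) * (meeting 𝓔 π 2).card +
      ((Nat.card K : ℚ) ^ 2 + Nat.card K + 1) * (meeting 𝓔 π 3).card ∧
    ∑ l ∈ subs ⊥ π 2, (deg 𝓔 l : ℚ) = (meeting 𝓔 π 2).card +
      ((Nat.card K : ℚ) ^ 2 + Nat.card K + 1) * (meeting 𝓔 π 3).card := by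
  have : FiniteDimensional K W := Module.Finite.of_finite
  refine ⟨?_, ?_, ?_⟩
  · have := sum_finrank_inf (𝓔 := 𝓔) (fun _ => 1) hπ
    simpa using this
  · rw [sum_deg, Finset.sum_congr rfl fun X _ => card_points rfl,
      sum_finrank_inf (fun n => ∑ i ∈ Finset.range n, (Nat.card K : ℚ) ^ i) hπ]
    simp only [Finset.sum_range_succ, Finset.sum_range_zero]
    ring
  · have h2 : ∀ Z : Submodule K W, finrank K Z ≤ 3 → ((subs ⊥ Z 2).card : ℚ) =
        (fun n => if n = 3 then (Nat.card K : ℚ) ^ 2 + Nat.card K + 1 else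
          if n = 2 then 1 else 0) (finrank K Z) := by
      intro Z hZ
      dsimp only
      split_ifs with h3 h2
      · exact card_subs_codim_three bot_le (finrank_bot K W) (by rw [h3])
      · have : subs ⊥ Z 2 = {Z} := by
          ext X
          rw [mem_subs, Finset.mem_singleton]
          constructor
          · rintro ⟨-, h4, h5⟩
            exact Submodule.eq_of_le_of_finrank_eq h4 (h5.trans h2.symm)
          · rintro rfl
            exact ⟨bot_le, le_rfl, h2⟩
        rw [this]
        simp
      · rw [Nat.cast_eq_zero, Finset.card_eq_zero]
        refine Finset.eq_empty_of_forall_notMem fun X hX => ?_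
        obtain ⟨-, h4, h5⟩ := mem_subs.1 hX
        have := Submodule.finrank_mono h4
        omega
    rw [sum_deg, Finset.sum_congr rfl fun X _ => h2 (π ⊓ X)
      (hπ ▸ Submodule.finrank_mono inf_le_left), sum_finrank_inf
      (fun n => if n = 3 then (Nat.card K : ℚ) ^ 2 + Nat.card K + 1 else if n = 2 then 1 else 0) hπ]
    norm_num
    ring

/-- The numbers of planes of a projective space of dimension five in the different positions to a
given plane. -/
theorem card_meeting_planes (hW : finrank K W = 6) (hπ : finrank K π = 3) :
    ((meeting (subs ⊥ ⊤ 3) π 0).card : ℚ) = (Nat.card K : ℚ) ^ 9 ∧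
    ((meeting (subs ⊥ ⊤ 3) π 1).card : ℚ) =
      (Nat.card K : ℚ) ^ 4 * ((Nat.card K : ℚ) ^ 2 + Nat.card K + 1) ^ 2 ∧
    ((meeting (subs ⊥ ⊤ 3) π 2).card : ℚ) =
      Nat.card K * ((Nat.card K : ℚ) ^ 2 + Nat.card K + 1) ^ 2 ∧
    ((meeting (subs ⊥ ⊤ 3) π 3).card : ℚ) = 1 := by
  classical
  have htop : finrank K (⊤ : Submodule K W) = 6 := finrank_top K W ▸ hW
  obtain ⟨h1, h2, h3⟩ := double_counts (𝓔 := subs ⊥ ⊤ 3) hπ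
  have h4 : (meeting (subs ⊥ ⊤ 3) π 3).card = 1 := by
    rw [card_meeting_three hπ fun X hX => (mem_subs.1 hX).2.2, if_pos]
    exact mem_subs.2 ⟨bot_le, le_top, hπ⟩
  rw [h4] at h1 h2 h3
  have h5 : ((subs (⊥ : Submodule K W) ⊤ 3).card : ℚ) = _ :=
    card_subs_six_three bot_le (finrank_bot K W) htop
  rw [h5] at h1
  rw [Finset.sum_congr rfl fun P hP => by
    rw [deg_subs, show 3 = 1 + 2 from rfl,
      card_subs_five_two le_top (mem_subs.1 hP).2.2 htop], Finset.sum_const, nsmul_eq_mul,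
    card_points hπ] at h2
  rw [Finset.sum_congr rfl fun l hl => by
    rw [deg_subs, card_subs_covering le_top 4 (mem_subs.1 hl).2.2 htop], Finset.sum_const,
    nsmul_eq_mul, show 2 = 0 + 2 from rfl,
    card_subs_codim_three bot_le (finrank_bot K W) (by rw [hπ])] at h3
  simp only [Finset.sum_range_succ, Finset.sum_range_zero] at h2 h3
  rw [h4]
  push_cast at *
  generalize (Nat.card K : ℚ) = q at *
  have h6 : ((meeting (subs ⊥ ⊤ 3) π 2).card : ℚ) = q * (q ^ 2 + q + 1) ^ 2 := by
    linear_combination -h3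
  have h7 : ((meeting (subs ⊥ ⊤ 3) π 1).card : ℚ) = q ^ 4 * (q ^ 2 + q + 1) ^ 2 := by
    rw [h6] at h2
    linear_combination -h2
  refine ⟨?_, h7, h6, rfl⟩
  rw [h6, h7] at h1
  linear_combination -h1

end Degrees

/-! ### The weight function of an extremal set of planes -/

section Weights

variable {K W : Type*} [Field K] [AddCommGroup W] [Module K W] [Finite W]

/-- A set of pairwise intersecting planes of a five-dimensional projective space whose size is the
largest possible, namely the number of planes on a point. -/
structure IsExtremal (𝓔 : Finset (Submodule K W)) : Prop where
  finrank_space : finrank K W = 6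
  finrank_eq : ∀ X ∈ 𝓔, finrank K X = 3
  inf_ne_bot : ∀ X ∈ 𝓔, ∀ Y ∈ 𝓔, X ⊓ Y ≠ ⊥
  card_eq : (𝓔.card : ℚ) = (Nat.card K : ℚ) ^ 6 + (Nat.card K : ℚ) ^ 5 +
    2 * (Nat.card K : ℚ) ^ 4 + 2 * (Nat.card K : ℚ) ^ 3 + 2 * (Nat.card K : ℚ) ^ 2 +
    Nat.card K + 1

/-- The weight of a point `P`: its degree in `𝓔`, rescaled so that it is one if all members of `𝓔`
contain `P`, and zero if the degree is that of a point other than the centre of a point-pencil of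
planes. -/
noncomputable def weight (𝓔 : Finset (Submodule K W)) (P : Submodule K W) : ℚ :=
  ((deg 𝓔 P : ℚ) - ((Nat.card K : ℚ) ^ 3 + (Nat.card K : ℚ) ^ 2 + Nat.card K + 1)) /
    ((Nat.card K : ℚ) ^ 2 * ((Nat.card K : ℚ) ^ 2 + 1) *
      ((Nat.card K : ℚ) ^ 2 + Nat.card K + 1))

/-- The sum of the weights of the points of `X`. -/
noncomputable def weightSum (𝓔 : Finset (Submodule K W)) (X : Submodule K W) : ℚ :=
  ∑ P ∈ subs ⊥ X 1, weight 𝓔 P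

variable [Finite K] {𝓔 : Finset (Submodule K W)}

omit [Finite W] in
theorem deg_eq_weight (𝓔 : Finset (Submodule K W)) (P : Submodule K W) :
    (deg 𝓔 P : ℚ) = (Nat.card K : ℚ) ^ 3 + (Nat.card K : ℚ) ^ 2 + Nat.card K + 1 +
      (Nat.card K : ℚ) ^ 2 * ((Nat.card K : ℚ) ^ 2 + 1) *
      ((Nat.card K : ℚ) ^ 2 + Nat.card K + 1) * weight 𝓔 P := by
  have hq := one_lt_natCard_cast (K := K)
  rw [weight, mul_div_cancel₀]
  · ring
  · generalize (Nat.card K : ℚ) = q at *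
    have : 0 < q := by linarith
    positivity

/-- The indicator function of an extremal set is the sum of the weights of the points of a plane:
this is the form in which the equality case of the bound is used. -/
theorem IsExtremal.weightSum_plane (h : IsExtremal 𝓔) {π : Submodule K W} (hπ : finrank K π = 3)
    [Decidable (π ∈ 𝓔)] : weightSum 𝓔 π = if π ∈ 𝓔 then 1 else 0 := by
  have hq := one_lt_natCard_cast (K := K)
  obtain ⟨h1, h2, -⟩ := double_counts (𝓔 := 𝓔) hπ
  obtain ⟨n0, n1, n2, n3⟩ := card_meeting_planes h.finrank_space hπ
  have htop : finrank K (⊤ : Submodule K W) = 6 := finrank_top K W ▸ h.finrank_space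
  have hN : ((subs (⊥ : Submodule K W) ⊤ 3).card : ℚ) = _ :=
    card_subs_six_three bot_le (finrank_bot K W) htop
  obtain ⟨r1, r2⟩ := (spread_bound_and_relations h.finrank_space h.finrank_eq h.inf_ne_bot).2
    (by
      rw [← Nat.cast_inj (R := ℚ), hN]
      push_cast
      rw [h.card_eq]) π hπ
  simp only [meetingRatio] at r1 r2
  rw [n0, n3] at r1
  rw [n0, n1, n2] at r2
  have h3 : ((meeting 𝓔 π 3).card : ℚ) = if π ∈ 𝓔 then 1 else 0 := by
    rw [card_meeting_three hπ h.finrank_eq]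
    push_cast
    rfl
  rw [← h3]
  rw [h.card_eq] at h1
  have hs : ∑ P ∈ subs ⊥ π 1, (deg 𝓔 P : ℚ) = ((Nat.card K : ℚ) ^ 2 + Nat.card K + 1) *
      ((Nat.card K : ℚ) ^ 3 + (Nat.card K : ℚ) ^ 2 + Nat.card K + 1) +
      (Nat.card K : ℚ) ^ 2 * ((Nat.card K : ℚ) ^ 2 + 1) *
      ((Nat.card K : ℚ) ^ 2 + Nat.card K + 1) * weightSum 𝓔 π := by
    rw [Finset.sum_congr rfl fun P _ => deg_eq_weight 𝓔 P, Finset.sum_add_distrib,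
      Finset.sum_const, nsmul_eq_mul, card_points hπ, ← Finset.mul_sum, weightSum]
    simp only [Finset.sum_range_succ, Finset.sum_range_zero]
    ring
  rw [hs] at h2
  generalize weightSum 𝓔 π = w at *
  generalize ((meeting 𝓔 π 0).card : ℚ) = a0 at *
  generalize ((meeting 𝓔 π 1).card : ℚ) = a1 at *
  generalize ((meeting 𝓔 π 2).card : ℚ) = a2 at *
  generalize ((meeting 𝓔 π 3).card : ℚ) = a3 at *
  generalize (Nat.card K : ℚ) = q at *
  have hq0 : 0 < q := by linarith
  have hm : 0 < q ^ 2 + q + 1 := by positivity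
  -- The spread relations and the size of `𝓔` determine `a0`, `a1`, `a2` from `a3`.
  have e1 : a0 = q ^ 6 * (1 - a3) := by
    field_simp at r1
    linear_combination r1
  have e2 : q * a2 + a1 = q ^ 2 * (q ^ 2 + q + 1) ^ 2 -
      q * (q - 1) * (q ^ 2 + q + 1) ^ 2 * (1 - a3) := by
    rw [e1] at r2
    field_simp at r2
    linear_combination r2
  have hα : (q - 1) * (q ^ 2 * (q ^ 2 + 1) * (q ^ 2 + q + 1)) ≠ 0 :=
    mul_ne_zero (by linarith) (by positivity)
  refine mul_left_cancel₀ hα ?_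
  linear_combination (q - 1) * h2 + q * e2 + h1 + e1

theorem IsExtremal.weightSum_top (h : IsExtremal 𝓔) : weightSum 𝓔 ⊤ = 1 := by
  have hq := one_lt_natCard_cast (K := K)
  have h1 := sum_deg 𝓔 ⊤ 1
  rw [Finset.sum_congr rfl fun P _ => deg_eq_weight 𝓔 P, Finset.sum_add_distrib,
    Finset.sum_const, nsmul_eq_mul, card_points ((finrank_top K W).trans h.finrank_space),
    ← Finset.mul_sum, Finset.sum_congr rfl fun X hX => card_points
      ((congrArg (fun Z : Submodule K W => finrank K Z) (top_inf_eq X)).trans (h.finrank_eq X hX)),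
    Finset.sum_const, nsmul_eq_mul, h.card_eq] at h1
  change _ + _ * weightSum 𝓔 ⊤ = _ at h1
  simp only [Finset.sum_range_succ, Finset.sum_range_zero] at h1
  generalize (Nat.card K : ℚ) = q at *
  have hq0 : 0 < q := by linarith
  have hα : q ^ 2 * (q ^ 2 + 1) * (q ^ 2 + q + 1) ≠ 0 := by positivity
  refine mul_left_cancel₀ hα ?_
  linear_combination h1

omit [Finite K] in
/-- Summing the weights of the subspaces of dimension `k` between `A` and `B`, each point `P` is
counted as often as there are such subspaces through `P`. -/
theorem sum_weightSum (𝓔 : Finset (Submodule K W)) (A B : Submodule K W) (k : ℕ) :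
    ∑ X ∈ subs A B k, weightSum 𝓔 X =
      ∑ P ∈ subs ⊥ B 1, (subs (A ⊔ P) B k).card * weight 𝓔 P := by
  classical
  simp only [weightSum]
  rw [Finset.sum_comm' (t' := subs ⊥ B 1) (s' := fun P => subs (A ⊔ P) B k)]
  · refine Finset.sum_congr rfl fun P _ => ?_
    rw [Finset.sum_const, nsmul_eq_mul]
  · intro X P
    simp only [mem_subs, bot_le, true_and, sup_le_iff]
    constructor
    · rintro ⟨⟨h1, h2, h3⟩, h4, h5⟩
      exact ⟨⟨⟨h1, h4⟩, h2, h3⟩, h4.trans h2, h5⟩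
    · rintro ⟨⟨⟨h1, h4⟩, h2, h3⟩, -, h5⟩
      exact ⟨⟨h1, h2, h3⟩, h4, h5⟩

omit [Finite K] in
theorem finrank_sup_point {A P : Submodule K W} {a : ℕ} (hA : finrank K A = a)
    (hP : finrank K P = 1) (hPA : ¬P ≤ A) : finrank K ↥(A ⊔ P) = a + 1 := by
  have : FiniteDimensional K W := Module.Finite.of_finite
  have h1 := Submodule.finrank_sup_add_finrank_inf_eq A P
  have h2 : finrank K ↥(A ⊓ P) ≤ 1 := hP ▸ Submodule.finrank_mono inf_le_right
  have h3 : finrank K ↥(A ⊓ P) ≠ 1 := fun h => hPA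
    (inf_eq_right.1 (Submodule.eq_of_le_of_finrank_eq inf_le_right (h.trans hP.symm)))
  omega

/-- The subspaces `X` covering `A` below `B` have total weight that of `B`, except that `A` is
counted for each of them. -/
theorem sum_weightSum_covering (𝓔 : Finset (Submodule K W)) {A B : Submodule K W} (hAB : A ≤ B)
    {a : ℕ} (n : ℕ) (hA : finrank K A = a) (hB : finrank K B = a + n) :
    ∑ X ∈ subs A B (a + 1), weightSum 𝓔 X = weightSum 𝓔 B +
      (∑ i ∈ Finset.range n, (Nat.card K : ℚ) ^ i - 1) * weightSum 𝓔 A := by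
  classical
  have hterm : ∀ P ∈ subs ⊥ B 1, (subs (A ⊔ P) B (a + 1)).card * weight 𝓔 P = weight 𝓔 P +
      if P ≤ A then (∑ i ∈ Finset.range n, (Nat.card K : ℚ) ^ i - 1) * weight 𝓔 P else 0 := by
    intro P hP
    obtain ⟨-, hPB, hP1⟩ := mem_subs.1 hP
    split_ifs with hPA
    · rw [sup_eq_left.2 hPA, card_subs_covering hAB n hA hB]
      ring
    · rw [card_subs_bottom (sup_le hAB hPB) (finrank_sup_point hA hP1 hPA), Nat.cast_one, one_mul,
        add_zero]
  rw [sum_weightSum, Finset.sum_congr rfl hterm, Finset.sum_add_distrib, ← Finset.sum_filter,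
    ← Finset.mul_sum]
  congr 2
  refine Finset.sum_congr ?_ fun _ _ => rfl
  ext P
  simp only [Finset.mem_filter, mem_subs, bot_le, true_and]
  constructor
  · rintro ⟨⟨-, h1⟩, h2⟩
    exact ⟨h2, h1⟩
  · rintro ⟨h2, h1⟩
    exact ⟨⟨h2.trans hAB, h1⟩, h2⟩

theorem IsExtremal.deg_line (h : IsExtremal 𝓔) {l : Submodule K W} (hl : finrank K l = 2) :
    (deg 𝓔 l : ℚ) = 1 + Nat.card K * ((Nat.card K : ℚ) ^ 2 + Nat.card K + 1) * weightSum 𝓔 l := by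
  classical
  have htop : finrank K (⊤ : Submodule K W) = 6 := finrank_top K W ▸ h.finrank_space
  have h1 := sum_weightSum_covering 𝓔 (le_top : l ≤ ⊤) 4 hl htop
  rw [h.weightSum_top, Finset.sum_congr rfl fun X hX => h.weightSum_plane (mem_subs.1 hX).2.2,
    Finset.sum_boole] at h1
  have h2 : (subs l ⊤ 3).filter (· ∈ 𝓔) = 𝓔.filter fun X => l ≤ X := by
    ext X
    simp only [Finset.mem_filter, mem_subs, le_top, true_and]
    exact ⟨fun ⟨⟨h3, _⟩, h4⟩ => ⟨h4, h3⟩, fun ⟨h4, h3⟩ => ⟨⟨h3, h.finrank_eq X h4⟩, h4⟩⟩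
  rw [h2] at h1
  have h3 : (deg 𝓔 l : ℚ) = ((𝓔.filter fun X => l ≤ X).card : ℚ) := by
    rw [deg]
  rw [h3, h1]
  simp only [Finset.sum_range_succ, Finset.sum_range_zero]
  ring

/-- If some member `X` of `𝓔` misses the line `l`, then the members through `l` are determined by
the points in which they meet `X`. -/
theorem IsExtremal.deg_le_of_inf_eq_bot (h : IsExtremal 𝓔) {l X : Submodule K W}
    (hl : finrank K l = 2) (hX : X ∈ 𝓔) (hlX : l ⊓ X = ⊥) :
    (deg 𝓔 l : ℚ) ≤ (Nat.card K : ℚ) ^ 2 + Nat.card K + 1 := by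
  classical
  have : FiniteDimensional K W := Module.Finite.of_finite
  have hpts := card_points (h.finrank_eq X hX)
  simp only [Finset.sum_range_succ, Finset.sum_range_zero] at hpts
  have key : ∀ Y ∈ 𝓔, l ≤ Y → finrank K ↥(Y ⊓ X) = 1 ∧ l ⊔ Y ⊓ X = Y := by
    intro Y hY hlY
    have h1 : 0 < finrank K ↥(Y ⊓ X) := by
      rw [Nat.pos_iff_ne_zero, Ne, Submodule.finrank_eq_zero]
      exact h.inf_ne_bot Y hY X hX
    have h2 := Submodule.finrank_sup_add_finrank_inf_eq l (Y ⊓ X)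
    have h3 : l ⊓ (Y ⊓ X) = ⊥ := le_bot_iff.1
      (hlX ▸ le_inf inf_le_left (inf_le_right.trans inf_le_right))
    have h4 : l ⊔ Y ⊓ X ≤ Y := sup_le hlY inf_le_left
    have h5 := Submodule.finrank_mono h4
    rw [h3, finrank_bot] at h2
    rw [h.finrank_eq Y hY] at h5
    exact ⟨by omega, Submodule.eq_of_le_of_finrank_eq h4 (by rw [h.finrank_eq Y hY]; omega)⟩
  have hle : deg 𝓔 l ≤ (subs ⊥ X 1).card := by
    rw [deg]
    refine Finset.card_le_card_of_injOn (fun Y => Y ⊓ X) ?_ ?_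
    · intro Y hY
      obtain ⟨h1, h2⟩ := Finset.mem_filter.1 hY
      exact mem_subs.2 ⟨bot_le, inf_le_right, (key Y h1 h2).1⟩
    · intro Y hY Z hZ hYZ
      obtain ⟨h1, h2⟩ := Finset.mem_filter.1 hY
      obtain ⟨h3, h4⟩ := Finset.mem_filter.1 hZ
      dsimp only at hYZ
      rw [← (key Y h1 h2).2, hYZ, (key Z h3 h4).2]
  have : (deg 𝓔 l : ℚ) ≤ ((subs ⊥ X 1).card : ℚ) := by exact_mod_cast hle
  rw [hpts] at this
  linarith

/-- A line met by all members of `𝓔` has weight one: count the incidences of its points with the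
members. -/
theorem IsExtremal.weightSum_eq_one_of_meets (h : IsExtremal 𝓔) {l : Submodule K W}
    (hl : finrank K l = 2) (hmeet : ∀ X ∈ 𝓔, l ⊓ X ≠ ⊥) : weightSum 𝓔 l = 1 := by
  classical
  have : FiniteDimensional K W := Module.Finite.of_finite
  have hq := one_lt_natCard_cast (K := K)
  have h1 := sum_deg 𝓔 l 1
  have h2 : ∀ X ∈ 𝓔, ((subs ⊥ (l ⊓ X) 1).card : ℚ) =
      1 + if l ≤ X then (Nat.card K : ℚ) else 0 := by
    intro X hX
    have h3 : 0 < finrank K ↥(l ⊓ X) := by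
      rw [Nat.pos_iff_ne_zero, Ne, Submodule.finrank_eq_zero]
      exact hmeet X hX
    split_ifs with hlX
    · rw [inf_eq_left.2 hlX, card_points hl]
      simp [Finset.sum_range_succ]
    · have h4 : finrank K ↥(l ⊓ X) < 2 := hl ▸ Submodule.finrank_lt_finrank_of_lt
        (lt_of_le_of_ne inf_le_left fun h => hlX (inf_eq_left.1 h))
      rw [card_points (show finrank K ↥(l ⊓ X) = 1 by omega)]
      simp
  have h5 : ∑ X ∈ 𝓔, (if l ≤ X then (Nat.card K : ℚ) else 0) = deg 𝓔 l * Nat.card K := by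
    rw [← Finset.sum_filter, Finset.sum_const, nsmul_eq_mul, deg]
  rw [Finset.sum_congr rfl h2, Finset.sum_add_distrib, h5, Finset.sum_const, nsmul_eq_mul,
    h.card_eq, h.deg_line hl, Finset.sum_congr rfl fun P _ => deg_eq_weight 𝓔 P,
    Finset.sum_add_distrib, Finset.sum_const, nsmul_eq_mul, card_points hl,
    ← Finset.mul_sum] at h1
  change _ + _ * weightSum 𝓔 l = _ at h1
  simp only [Finset.sum_range_succ, Finset.sum_range_zero] at h1
  generalize (Nat.card K : ℚ) = q at *
  have hq0 : 0 < q := by linarith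
  have hc : q ^ 4 * (q ^ 2 + q + 1) ≠ 0 := by positivity
  refine mul_left_cancel₀ hc ?_
  linear_combination h1

theorem IsExtremal.weightSum_line (h : IsExtremal 𝓔) {l : Submodule K W}
    (hl : finrank K l = 2) : weightSum 𝓔 l = 1 ∨
      weightSum 𝓔 l * ((Nat.card K : ℚ) ^ 2 + Nat.card K + 1) ≤ Nat.card K + 1 := by
  have hq := one_lt_natCard_cast (K := K)
  by_cases hmeet : ∀ X ∈ 𝓔, l ⊓ X ≠ ⊥
  · exact Or.inl (h.weightSum_eq_one_of_meets hl hmeet)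
  · push Not at hmeet
    obtain ⟨X, hX, hlX⟩ := hmeet
    have h1 := h.deg_le_of_inf_eq_bot hl hX hlX
    rw [h.deg_line hl] at h1
    right
    have hq0 : (0 : ℚ) < Nat.card K := by linarith
    refine le_of_mul_le_mul_left ?_ hq0
    linarith

theorem IsExtremal.meets_of_weightSum_eq_one (h : IsExtremal 𝓔) {l : Submodule K W}
    (hl : finrank K l = 2) (hw : weightSum 𝓔 l = 1) {X : Submodule K W} (hX : X ∈ 𝓔) :
    l ⊓ X ≠ ⊥ := by
  intro hlX
  have hq := one_lt_natCard_cast (K := K)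
  have h1 := h.deg_le_of_inf_eq_bot hl hX hlX
  rw [h.deg_line hl, hw] at h1
  generalize (Nat.card K : ℚ) = q at *
  have : 0 < q ^ 3 := by positivity
  nlinarith

theorem IsExtremal.mem_of_le (h : IsExtremal 𝓔) {l : Submodule K W}
    (hl : finrank K l = 2) (hw : weightSum 𝓔 l = 1) {π : Submodule K W} (hlπ : l ≤ π)
    (hπ : finrank K π = 3) : π ∈ 𝓔 := by
  classical
  have htop : finrank K (⊤ : Submodule K W) = 6 := finrank_top K W ▸ h.finrank_space
  have hsub : 𝓔.filter (fun X => l ≤ X) ⊆ subs l ⊤ 3 := by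
    intro X hX
    obtain ⟨h1, h2⟩ := Finset.mem_filter.1 hX
    exact mem_subs.2 ⟨h2, le_top, h.finrank_eq X h1⟩
  have hcard : (subs l ⊤ 3).card = (𝓔.filter fun X => l ≤ X).card := by
    have h1 := h.deg_line hl
    have h2 := card_subs_covering (le_top : l ≤ ⊤) 4 hl htop
    rw [hw, deg] at h1
    rw [← Nat.cast_inj (R := ℚ), h2]
    simp only [Finset.sum_range_succ, Finset.sum_range_zero]
    linear_combination -h1
  have := Finset.eq_of_subset_of_card_le hsub hcard.le
  exact (Finset.mem_filter.1 (this.symm ▸ mem_subs.2 ⟨hlπ, le_top, hπ⟩ :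
    π ∈ 𝓔.filter fun X => l ≤ X)).1

omit [Finite K] in
theorem weightSum_point {P : Submodule K W} (hP : finrank K P = 1) :
    weightSum 𝓔 P = weight 𝓔 P := by
  have : FiniteDimensional K W := Module.Finite.of_finite
  have : subs ⊥ P 1 = {P} := by
    ext R
    rw [mem_subs, Finset.mem_singleton]
    constructor
    · rintro ⟨-, h4, h5⟩
      exact Submodule.eq_of_le_of_finrank_eq h4 (h5.trans hP.symm)
    · rintro rfl
      exact ⟨bot_le, le_rfl, hP⟩
  rw [weightSum, this, Finset.sum_singleton]

/-- The lines of a member of `𝓔` have average weight `(q + 1) / (q ^ 2 + q + 1)`. If no line has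
larger weight, then all have this weight, and the weight is constant on the points of the
plane. -/
theorem IsExtremal.weight_of_forall_line (h : IsExtremal 𝓔) {π : Submodule K W} (hπ : π ∈ 𝓔)
    (hno : ∀ l ≤ π, finrank K l = 2 → weightSum 𝓔 l ≠ 1) {P : Submodule K W}
    (hP : finrank K P = 1) (hPπ : P ≤ π) :
    weight 𝓔 P * ((Nat.card K : ℚ) ^ 2 + Nat.card K + 1) = 1 := by
  classical
  have hq := one_lt_natCard_cast (K := K)
  have hπ3 := h.finrank_eq π hπ
  have hwπ : weightSum 𝓔 π = 1 := by rw [h.weightSum_plane hπ3, if_pos hπ]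
  have hm : (0 : ℚ) < (Nat.card K : ℚ) ^ 2 + Nat.card K + 1 := by positivity
  have hle : ∀ l ∈ subs ⊥ π 2, weightSum 𝓔 l ≤
      (Nat.card K + 1) / ((Nat.card K : ℚ) ^ 2 + Nat.card K + 1) := by
    intro l hl
    obtain ⟨-, h1, h2⟩ := mem_subs.1 hl
    rw [le_div_iff₀ hm]
    exact (h.weightSum_line h2).resolve_left (hno l h1 h2)
  have hsum : ∑ l ∈ subs ⊥ π 2, weightSum 𝓔 l = ∑ l ∈ subs ⊥ π 2,
      ((Nat.card K + 1) / ((Nat.card K : ℚ) ^ 2 + Nat.card K + 1)) := by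
    rw [sum_weightSum, Finset.sum_congr rfl fun P hP => by
      rw [bot_sup_eq, card_subs_covering (mem_subs.1 hP).2.1 2 (mem_subs.1 hP).2.2 hπ3],
      ← Finset.mul_sum, Finset.sum_const, nsmul_eq_mul, show 2 = 0 + 2 from rfl,
      card_subs_codim_three bot_le (finrank_bot K W) (by rw [hπ3])]
    change _ * weightSum 𝓔 π = _
    rw [hwπ, mul_div_cancel₀ _ hm.ne']
    simp [Finset.sum_range_succ, add_comm]
  have heq := (Finset.sum_eq_sum_iff_of_le hle).1 hsum
  have h1 := sum_weightSum_covering 𝓔 hPπ 2 hP hπ3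
  have h2 : ∀ l ∈ subs P π (1 + 1), weightSum 𝓔 l =
      (Nat.card K + 1) / ((Nat.card K : ℚ) ^ 2 + Nat.card K + 1) := by
    intro l hl
    obtain ⟨-, h3, h4⟩ := mem_subs.1 hl
    exact heq l (mem_subs.2 ⟨bot_le, h3, h4⟩)
  rw [Finset.sum_congr rfl h2, Finset.sum_const, nsmul_eq_mul,
    card_subs_covering hPπ 2 hP hπ3, hwπ, weightSum_point hP] at h1
  simp only [Finset.sum_range_succ, Finset.sum_range_zero] at h1
  generalize (Nat.card K : ℚ) = q at *
  have hq0 : q ≠ 0 := by linarith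
  refine mul_left_cancel₀ hq0 ?_
  field_simp at h1
  linear_combination -h1

end Weights

/-! ### The case of equality in the Erdős–Ko–Rado theorem for planes -/

section EqualityCase

variable {K W : Type*} [Field K] [AddCommGroup W] [Module K W] [Finite W] [Finite K]
  {𝓔 : Finset (Submodule K W)}

/-- If no line has weight one, then all points covered by `𝓔` have the same positive weight. -/
theorem IsExtremal.weight_of_covered (h : IsExtremal 𝓔)
    (hno : ∀ l : Submodule K W, finrank K l = 2 → weightSum 𝓔 l ≠ 1) {P : Submodule K W}
    (hP : finrank K P = 1) (hcov : ∃ X ∈ 𝓔, P ≤ X) :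
    weight 𝓔 P = 1 / ((Nat.card K : ℚ) ^ 2 + Nat.card K + 1) := by
  obtain ⟨X, hX, hPX⟩ := hcov
  have hm : (Nat.card K : ℚ) ^ 2 + Nat.card K + 1 ≠ 0 := by positivity
  rw [eq_div_iff hm]
  exact h.weight_of_forall_line hX (fun l _ hl => hno l hl) hP hPX

/-- If no line has weight one, then a line with two covered points has only covered points. -/
theorem IsExtremal.covered_of_le_sup (h : IsExtremal 𝓔)
    (hno : ∀ l : Submodule K W, finrank K l = 2 → weightSum 𝓔 l ≠ 1) {P Q R : Submodule K W}
    (hP : finrank K P = 1) (hPc : ∃ X ∈ 𝓔, P ≤ X) (hQ : finrank K Q = 1) (hQc : ∃ X ∈ 𝓔, Q ≤ X)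
    (hPQ : P ≠ Q) (hRPQ : R ≤ P ⊔ Q) : ∃ X ∈ 𝓔, R ≤ X := by
  classical
  have : FiniteDimensional K W := Module.Finite.of_finite
  by_contra hRc
  have hq := one_lt_natCard_cast (K := K)
  have hl : finrank K ↥(P ⊔ Q) = 2 := finrank_sup_point hP hQ fun hle =>
    hPQ (Submodule.eq_of_le_of_finrank_eq hle (hQ.trans hP.symm)).symm
  have hdeg : ∀ A : Submodule K W, (¬∃ X ∈ 𝓔, A ≤ X) → deg 𝓔 A = 0 := by
    intro A hA
    rw [deg, Finset.card_eq_zero]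
    exact Finset.filter_eq_empty_iff.2 fun X hX hAX => hA ⟨X, hX, hAX⟩
  have hdl := h.deg_line hl
  rw [hdeg _ fun ⟨X, hX, hle⟩ => hRc ⟨X, hX, hRPQ.trans hle⟩] at hdl
  have hunc : ∀ A ∈ (subs ⊥ (P ⊔ Q) 1).filter (fun A => ¬∃ X ∈ 𝓔, A ≤ X), weight 𝓔 A =
      (0 - ((Nat.card K : ℚ) ^ 3 + (Nat.card K : ℚ) ^ 2 + Nat.card K + 1)) /
        ((Nat.card K : ℚ) ^ 2 * ((Nat.card K : ℚ) ^ 2 + 1) *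
          ((Nat.card K : ℚ) ^ 2 + Nat.card K + 1)) := by
    intro A hA
    rw [weight, hdeg A (Finset.mem_filter.1 hA).2, Nat.cast_zero]
  set cov := (subs ⊥ (P ⊔ Q) 1).filter fun A => ∃ X ∈ 𝓔, A ≤ X with hcov
  have hsplit := Finset.sum_filter_add_sum_filter_not (subs ⊥ (P ⊔ Q) 1)
    (fun A => ∃ X ∈ 𝓔, A ≤ X) (weight 𝓔)
  have hcards := Finset.card_filter_add_card_filter_not (s := subs ⊥ (P ⊔ Q) 1)
    (fun A => ∃ X ∈ 𝓔, A ≤ X)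
  change _ = weightSum 𝓔 (P ⊔ Q) at hsplit
  rw [← Nat.cast_inj (R := ℚ), card_points hl, Nat.cast_add] at hcards
  rw [Finset.sum_congr rfl fun A hA => h.weight_of_covered hno
    (mem_subs.1 (Finset.mem_filter.1 hA).1).2.2 (Finset.mem_filter.1 hA).2,
    Finset.sum_congr rfl hunc, Finset.sum_const, Finset.sum_const, nsmul_eq_mul,
    nsmul_eq_mul] at hsplit
  have htwo : 2 ≤ cov.card := by
    rw [← Finset.card_pair hPQ]
    refine Finset.card_le_card ?_
    intro A hA
    rw [Finset.mem_insert, Finset.mem_singleton] at hA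
    rcases hA with rfl | rfl
    · exact Finset.mem_filter.2 ⟨mem_subs.2 ⟨bot_le, le_sup_left, hP⟩, hPc⟩
    · exact Finset.mem_filter.2 ⟨mem_subs.2 ⟨bot_le, le_sup_right, hQ⟩, hQc⟩
  have htwo' : (2 : ℚ) ≤ cov.card := by exact_mod_cast htwo
  rw [← hcov] at hsplit hcards
  simp only [Finset.sum_range_succ, Finset.sum_range_zero] at hcards
  push_cast at hdl
  generalize (((subs ⊥ (P ⊔ Q) 1).filter fun A => ¬∃ X ∈ 𝓔, A ≤ X).card : ℚ) = u at *
  generalize (cov.card : ℚ) = c at *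
  generalize weightSum 𝓔 (P ⊔ Q) = w at *
  generalize (Nat.card K : ℚ) = q at *
  have hq0 : 0 < q := by linarith
  have hu : u = q + 1 - c := by linear_combination hcards
  rw [← hsplit, hu] at hdl
  have h1 : (q ^ 2 + q + 1) * (c - 1) = 0 := by
    have h2 : q ^ 3 + q ^ 2 + q + 1 = (q + 1) * (q ^ 2 + 1) := by ring
    rw [h2] at hdl
    field_simp at hdl
    refine mul_left_cancel₀ (show q ^ 2 + 1 ≠ 0 by positivity) ?_
    linear_combination -hdl
  rcases mul_eq_zero.1 h1 with h2 | h2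
  · have : 0 < q ^ 2 + q + 1 := by positivity
    linarith
  · linarith

/-- If no line has weight one, then the covered points are the points of a proper subspace. -/
theorem IsExtremal.exists_ne_top_of_forall_line (h : IsExtremal 𝓔)
    (hno : ∀ l : Submodule K W, finrank K l = 2 → weightSum 𝓔 l ≠ 1) :
    ∃ U : Submodule K W, U ≠ ⊤ ∧ ∀ X ∈ 𝓔, X ≤ U := by
  classical
  have hq := one_lt_natCard_cast (K := K)
  have hspan : ∀ {v : W}, v ≠ 0 → finrank K (Submodule.span K {v}) = 1 := fun hv =>
    finrank_span_singleton hv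
  let U : Submodule K W :=
    { carrier := {v | v = 0 ∨ ∃ X ∈ 𝓔, v ∈ X}
      zero_mem' := Or.inl rfl
      smul_mem' := by
        rintro c v (rfl | ⟨X, hX, hv⟩)
        · exact Or.inl (smul_zero c)
        · exact Or.inr ⟨X, hX, X.smul_mem c hv⟩
      add_mem' := by
        rintro v w hv hw
        by_cases hv0 : v = 0
        · simpa [hv0] using hw
        by_cases hw0 : w = 0
        · simpa [hw0] using hv
        by_cases hvw0 : v + w = 0
        · exact Or.inl hvw0
        right
        obtain ⟨X, hX, hvX⟩ := hv.resolve_left hv0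
        obtain ⟨Y, hY, hwY⟩ := hw.resolve_left hw0
        have h1 := (Submodule.span_singleton_le_iff_mem v X).2 hvX
        have h2 := (Submodule.span_singleton_le_iff_mem w Y).2 hwY
        by_cases heq : Submodule.span K {v} = Submodule.span K {w}
        · exact ⟨X, hX, X.add_mem hvX ((Submodule.span_singleton_le_iff_mem w X).1 (heq ▸ h1))⟩
        · obtain ⟨Z, hZ, hle⟩ := h.covered_of_le_sup hno (hspan hv0) ⟨X, hX, h1⟩ (hspan hw0)
            ⟨Y, hY, h2⟩ heq
            ((Submodule.span_singleton_le_iff_mem _ _).2 (Submodule.add_mem_sup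
              (Submodule.mem_span_singleton_self v) (Submodule.mem_span_singleton_self w)))
          exact ⟨Z, hZ, (Submodule.span_singleton_le_iff_mem _ Z).1 hle⟩ }
  refine ⟨U, fun htop => ?_, fun X hX v hv => Or.inr ⟨X, hX, hv⟩⟩
  -- If all points are covered, then all have weight `1 / (q ^ 2 + q + 1)`: the total is too large.
  have hall : ∀ P ∈ subs (⊥ : Submodule K W) ⊤ 1,
      weight 𝓔 P = 1 / ((Nat.card K : ℚ) ^ 2 + Nat.card K + 1) := by
    intro P hP
    have hP1 := (mem_subs.1 hP).2.2
    refine h.weight_of_covered hno hP1 ?_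
    obtain ⟨v, hv0, hv⟩ := finrank_eq_one_iff'.1 hP1
    have hvU : (v : W) ∈ U := htop ▸ Submodule.mem_top
    obtain ⟨X, hX, hvX⟩ := hvU.resolve_left fun h0 => hv0 (Subtype.ext h0)
    refine ⟨X, hX, fun w hw => ?_⟩
    obtain ⟨c, hc⟩ := hv ⟨w, hw⟩
    have : c • (v : W) = w := congrArg Subtype.val hc
    exact this ▸ X.smul_mem c hvX
  have h1 := h.weightSum_top
  rw [weightSum, Finset.sum_congr rfl hall, Finset.sum_const, nsmul_eq_mul,
    card_points ((finrank_top K W).trans h.finrank_space)] at h1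
  simp only [Finset.sum_range_succ, Finset.sum_range_zero] at h1
  generalize (Nat.card K : ℚ) = q at *
  have hq0 : 0 < q := by linarith
  field_simp at h1
  have : 0 < q ^ 5 + q ^ 4 + q ^ 3 := by positivity
  linarith

/-- Two lines of weight one meet: all planes through one of them belong to `𝓔`, and some plane
through it misses the other if they are disjoint. -/
theorem IsExtremal.inf_ne_bot_of_weightSum_eq_one (h : IsExtremal 𝓔) {l m : Submodule K W}
    (hl : finrank K l = 2) (hlw : weightSum 𝓔 l = 1) (hm : finrank K m = 2)
    (hmw : weightSum 𝓔 m = 1) : l ⊓ m ≠ ⊥ := by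
  have : FiniteDimensional K W := Module.Finite.of_finite
  intro hlm
  have h1 := Submodule.finrank_sup_add_finrank_inf_eq l m
  rw [hlm, finrank_bot] at h1
  obtain ⟨v, -, hv⟩ := SetLike.exists_of_lt (lt_top_iff_ne_top.2 fun htop : l ⊔ m = ⊤ => by
    rw [htop, finrank_top, h.finrank_space] at h1
    omega)
  have hv0 : v ≠ 0 := fun h0 => hv (h0 ▸ Submodule.zero_mem _)
  have hR : finrank K (Submodule.span K {v}) = 1 := finrank_span_singleton hv0
  set R := Submodule.span K {v}
  have hRlm : ¬R ≤ l ⊔ m := fun hle => hv ((Submodule.span_singleton_le_iff_mem _ _).1 hle)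
  have h2 := finrank_sup_point hm hR fun hle => hRlm (hle.trans le_sup_right)
  have h3 := finrank_sup_point rfl hR hRlm
  refine h.meets_of_weightSum_eq_one hl hlw (h.mem_of_le hm hmw le_sup_left h2) ?_
  have h4 := Submodule.finrank_sup_add_finrank_inf_eq l (m ⊔ R)
  rw [← sup_assoc] at h4
  rw [← Submodule.finrank_eq_zero (R := K)]
  omega

/-- Let `l` and `m` be distinct lines of weight one through the point `P`. A member of `𝓔` that
does not contain `P` meets both, and hence meets the plane `l ⊔ m` in a line. There are so few
planes of `𝓔` through the lines of `l ⊔ m` off `P` that `P` lies in all members of `𝓔`. -/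
theorem IsExtremal.le_of_two_lines (h : IsExtremal 𝓔) {P l m : Submodule K W}
    (hP : finrank K P = 1) (hl : finrank K l = 2) (hlw : weightSum 𝓔 l = 1)
    (hm : finrank K m = 2) (hmw : weightSum 𝓔 m = 1) (hlm : l ⊓ m = P) :
    ∀ X ∈ 𝓔, P ≤ X := by
  classical
  have : FiniteDimensional K W := Module.Finite.of_finite
  have hq := one_lt_natCard_cast (K := K)
  have hρ : finrank K ↥(l ⊔ m) = 3 := by
    have := Submodule.finrank_sup_add_finrank_inf_eq l m
    rw [hlm] at this
    omega
  set ρ := l ⊔ m with hρdef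
  have hρ𝓔 : ρ ∈ 𝓔 := h.mem_of_le hl hlw le_sup_left hρ
  have hPρ : P ≤ ρ := hlm ▸ inf_le_left.trans le_sup_left
  have hρw : weightSum 𝓔 ρ = 1 := by rw [h.weightSum_plane hρ, if_pos hρ𝓔]
  set lines := (subs ⊥ ρ 2).filter fun n => ¬P ≤ n with hlines
  have hmaps : ∀ X ∈ 𝓔.filter (fun X => ¬P ≤ X), X ⊓ ρ ∈ lines := by
    intro X hX
    obtain ⟨hX𝓔, hPX⟩ := Finset.mem_filter.1 hX
    have h1 : 0 < finrank K ↥(l ⊓ X) := by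
      rw [Nat.pos_iff_ne_zero, Ne, Submodule.finrank_eq_zero]
      exact h.meets_of_weightSum_eq_one hl hlw hX𝓔
    have h2 : 0 < finrank K ↥(m ⊓ X) := by
      rw [Nat.pos_iff_ne_zero, Ne, Submodule.finrank_eq_zero]
      exact h.meets_of_weightSum_eq_one hm hmw hX𝓔
    have h3 : finrank K ↥((l ⊓ X) ⊓ (m ⊓ X)) = 0 := by
      have h4 : (l ⊓ X) ⊓ (m ⊓ X) ≤ P := hlm ▸ inf_le_inf inf_le_left inf_le_left
      have h5 := Submodule.finrank_mono h4
      by_contra h6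
      have h7 := Submodule.eq_of_le_of_finrank_eq h4 (by omega)
      exact hPX (h7 ▸ inf_le_left.trans inf_le_right)
    have h4 := Submodule.finrank_sup_add_finrank_inf_eq (l ⊓ X) (m ⊓ X)
    have h5 : (l ⊓ X) ⊔ (m ⊓ X) ≤ X ⊓ ρ :=
      sup_le (le_inf inf_le_right (inf_le_left.trans le_sup_left))
        (le_inf inf_le_right (inf_le_left.trans le_sup_right))
    have h6 := Submodule.finrank_mono h5
    have h7 : finrank K ↥(X ⊓ ρ) < 3 := hρ ▸ Submodule.finrank_lt_finrank_of_lt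
      (lt_of_le_of_ne inf_le_right fun h8 => hPX (hPρ.trans (inf_eq_right.1 h8)))
    refine Finset.mem_filter.2 ⟨mem_subs.2 ⟨bot_le, inf_le_right, by omega⟩, fun hle => ?_⟩
    exact hPX (hle.trans inf_le_left)
  -- The plane `ρ` itself is a member of `𝓔` through `n`, but contains `P`.
  have hfib : ∀ n ∈ lines, (((𝓔.filter fun X => ¬P ≤ X).filter fun X => X ⊓ ρ = n).card : ℚ) ≤
      deg 𝓔 n - 1 := by
    intro n hn
    obtain ⟨hn1, hPn⟩ := Finset.mem_filter.1 hn
    have hsub : insert ρ ((𝓔.filter fun X => ¬P ≤ X).filter fun X => X ⊓ ρ = n) ⊆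
        𝓔.filter fun X => n ≤ X := by
      intro X hX
      rcases Finset.mem_insert.1 hX with rfl | hX
      · exact Finset.mem_filter.2 ⟨hρ𝓔, (mem_subs.1 hn1).2.1⟩
      · obtain ⟨h1, h2⟩ := Finset.mem_filter.1 hX
        exact Finset.mem_filter.2 ⟨(Finset.mem_filter.1 h1).1, h2 ▸ inf_le_left⟩
    have hnot : ρ ∉ (𝓔.filter fun X => ¬P ≤ X).filter fun X => X ⊓ ρ = n := fun hmem =>
      (Finset.mem_filter.1 (Finset.mem_filter.1 hmem).1).2 hPρ
    have h1 := Finset.card_le_card hsub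
    rw [Finset.card_insert_of_notMem hnot] at h1
    have h2 : ((_ : ℕ) : ℚ) ≤ _ := Nat.cast_le.2 h1
    push_cast at h2
    rw [deg]
    linarith
  have hcount : ((𝓔.filter fun X => ¬P ≤ X).card : ℚ) ≤ ∑ n ∈ lines, ((deg 𝓔 n : ℚ) - 1) := by
    rw [Finset.card_eq_sum_card_fiberwise hmaps, Nat.cast_sum]
    exact Finset.sum_le_sum hfib
  have hlsum : ∑ n ∈ lines, weightSum 𝓔 n = Nat.card K * (1 - weight 𝓔 P) := by
    have h1 := Finset.sum_filter_add_sum_filter_not (subs ⊥ ρ 2) (fun n => P ≤ n) (weightSum 𝓔)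
    have h2 : (subs ⊥ ρ 2).filter (fun n => P ≤ n) = subs P ρ (1 + 1) := by
      ext n
      simp only [Finset.mem_filter, mem_subs, bot_le, true_and]
      tauto
    have h3 : ∑ n ∈ subs ⊥ ρ 2, weightSum 𝓔 n = (Nat.card K + 1) * weightSum 𝓔 ρ := by
      rw [sum_weightSum, Finset.sum_congr rfl fun P hP => by
        rw [bot_sup_eq, card_subs_covering (mem_subs.1 hP).2.1 2 (mem_subs.1 hP).2.2 hρ],
        ← Finset.mul_sum]
      simp [Finset.sum_range_succ, add_comm, weightSum]
    rw [h2, sum_weightSum_covering 𝓔 hPρ 2 hP hρ, h3, hρw, weightSum_point hP] at h1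
    simp only [Finset.sum_range_succ, Finset.sum_range_zero] at h1
    linear_combination h1
  rw [Finset.sum_congr rfl fun n hn => by
    rw [h.deg_line (mem_subs.1 (Finset.mem_filter.1 hn).1).2.2, add_sub_cancel_left],
    ← Finset.mul_sum, hlsum] at hcount
  have hdeg : ((𝓔.filter fun X => ¬P ≤ X).card : ℚ) = 𝓔.card - deg 𝓔 P := by
    rw [deg, eq_sub_iff_add_eq, add_comm]
    exact_mod_cast Finset.card_filter_add_card_filter_not (s := 𝓔) (fun X => P ≤ X)
  have hzero : ((𝓔.filter fun X => ¬P ≤ X).card : ℚ) ≤ 0 := by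
    have h1 := hdeg
    rw [h.card_eq, deg_eq_weight] at h1
    rw [h1] at hcount ⊢
    generalize (Nat.card K : ℚ) = q at *
    generalize weight 𝓔 P = g at *
    have hq0 : 0 < q := by linarith
    have h2 : q ^ 4 * (q ^ 2 + q + 1) * (1 - g) ≤ 0 := by linarith
    have h3 : 1 - g ≤ 0 := by
      by_contra hg
      push Not at hg
      have : 0 < q ^ 4 * (q ^ 2 + q + 1) * (1 - g) := by positivity
      linarith
    have h4 : q ^ 2 * (q ^ 2 + 1) * (q ^ 2 + q + 1) * (1 - g) ≤ 0 :=
      mul_nonpos_of_nonneg_of_nonpos (by positivity) h3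
    linarith
  have hempty : (𝓔.filter fun X => ¬P ≤ X) = ∅ := by
    rw [← Finset.card_eq_zero]
    exact_mod_cast le_antisymm hzero (by positivity)
  intro X hX
  by_contra hPX
  exact Finset.notMem_empty X (hempty ▸ Finset.mem_filter.2 ⟨hX, hPX⟩)

/-- If some line has weight one, then some point lies in all members of `𝓔`. -/
theorem IsExtremal.exists_point_of_line (h : IsExtremal 𝓔) {l : Submodule K W}
    (hl : finrank K l = 2) (hlw : weightSum 𝓔 l = 1) :
    ∃ P : Submodule K W, finrank K P = 1 ∧ ∀ X ∈ 𝓔, P ≤ X := by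
  classical
  have : FiniteDimensional K W := Module.Finite.of_finite
  have hq := one_lt_natCard_cast (K := K)
  have hcard := card_points hl
  simp only [Finset.sum_range_succ, Finset.sum_range_zero, pow_zero, pow_one, zero_add] at hcard
  -- The weights of the `q + 1` points of `l` add up to one.
  obtain ⟨P, hPl, hPw⟩ : ∃ P ∈ subs ⊥ l 1, 1 / ((Nat.card K : ℚ) + 1) ≤ weight 𝓔 P := by
    refine Finset.exists_le_of_sum_le ?_ ?_
    · rw [← Finset.card_pos]
      have : (0 : ℚ) < (subs ⊥ l 1).card := by rw [hcard]; positivity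
      exact_mod_cast this
    · change _ ≤ weightSum 𝓔 l
      rw [hlw, Finset.sum_const, nsmul_eq_mul, hcard, add_comm, mul_one_div_cancel (by positivity)]
  obtain ⟨-, hPl, hP⟩ := mem_subs.1 hPl
  have hdeg : deg 𝓔 l < deg 𝓔 P := by
    have h1 := h.deg_line hl
    have h2 := deg_eq_weight 𝓔 P
    have h3 : 0 < weight 𝓔 P := lt_of_lt_of_le (by positivity) hPw
    have h4 : (deg 𝓔 l : ℚ) < deg 𝓔 P := by
      rw [h1, h2, hlw]
      have : 0 < (Nat.card K : ℚ) ^ 2 * ((Nat.card K : ℚ) ^ 2 + 1) *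
        ((Nat.card K : ℚ) ^ 2 + Nat.card K + 1) * weight 𝓔 P := by positivity
      linarith
    exact_mod_cast h4
  obtain ⟨X, hX, hPX, hlX⟩ : ∃ X ∈ 𝓔, P ≤ X ∧ ¬l ≤ X := by
    by_contra hcon
    push Not at hcon
    refine hdeg.not_ge (Finset.card_le_card fun X hX => ?_)
    obtain ⟨h1, h2⟩ := Finset.mem_filter.1 hX
    exact Finset.mem_filter.2 ⟨h1, hcon X h1 h2⟩
  have hXl : l ⊓ X = P := by
    refine (Submodule.eq_of_le_of_finrank_le (le_inf hPl hPX) ?_).symm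
    have := Submodule.finrank_lt_finrank_of_lt
      (lt_of_le_of_ne (inf_le_left : l ⊓ X ≤ l) fun h1 => hlX (inf_eq_left.1 h1))
    omega
  -- The weight of `P` is too large for a plane all of whose points have the same weight.
  obtain ⟨m, hmX, hm, hmw⟩ : ∃ m ≤ X, finrank K m = 2 ∧ weightSum 𝓔 m = 1 := by
    by_contra hcon
    push Not at hcon
    have h1 := h.weight_of_forall_line hX hcon hP hPX
    have h2 : (0 : ℚ) < (Nat.card K : ℚ) ^ 2 + Nat.card K + 1 := by positivity
    rw [← eq_div_iff h2.ne'] at h1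
    rw [h1, div_le_div_iff₀ (by positivity) h2] at hPw
    nlinarith
  have hlm : l ⊓ m ≠ ⊥ := h.inf_ne_bot_of_weightSum_eq_one hl hlw hm hmw
  refine ⟨P, hP, h.le_of_two_lines hP hl hlw hm hmw ?_⟩
  refine Submodule.eq_of_le_of_finrank_le (hXl ▸ inf_le_inf_left l hmX) ?_
  rw [hP, Nat.one_le_iff_ne_zero, Ne, Submodule.finrank_eq_zero]
  exact hlm

/-- The Erdős–Ko–Rado theorem for planes of a five-dimensional projective space, with the
characterization of the case of equality. -/
theorem erdosKoRado_planes (hW : finrank K W = 6) (h𝓔 : ∀ X ∈ 𝓔, finrank K X = 3)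
    (hint : ∀ X ∈ 𝓔, ∀ Y ∈ 𝓔, X ⊓ Y ≠ ⊥) :
    (𝓔.card : ℚ) ≤ (Nat.card K : ℚ) ^ 6 + (Nat.card K : ℚ) ^ 5 + 2 * (Nat.card K : ℚ) ^ 4 +
      2 * (Nat.card K : ℚ) ^ 3 + 2 * (Nat.card K : ℚ) ^ 2 + Nat.card K + 1 ∧
    ((𝓔.card : ℚ) = (Nat.card K : ℚ) ^ 6 + (Nat.card K : ℚ) ^ 5 + 2 * (Nat.card K : ℚ) ^ 4 +
      2 * (Nat.card K : ℚ) ^ 3 + 2 * (Nat.card K : ℚ) ^ 2 + Nat.card K + 1 →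
      (∃ P : Submodule K W, finrank K P = 1 ∧ ∀ X ∈ 𝓔, P ≤ X) ∨
      ∃ U : Submodule K W, finrank K U = 5 ∧ ∀ X ∈ 𝓔, X ≤ U) := by
  have : FiniteDimensional K W := Module.Finite.of_finite
  constructor
  · have h1 := (spread_bound_and_relations hW h𝓔 hint).1
    have h2 := card_subs_six_three (bot_le : (⊥ : Submodule K W) ≤ ⊤) (finrank_bot K W)
      (by rw [finrank_top, hW])
    have h3 : ((_ : ℕ) : ℚ) ≤ _ := Nat.cast_le.2 h1
    rw [zero_add] at h2
    rw [h2] at h3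
    push_cast at h3
    exact le_of_mul_le_mul_left h3 (by positivity)
  · intro hcard
    have h : IsExtremal 𝓔 := ⟨hW, h𝓔, hint, hcard⟩
    by_cases hex : ∃ l : Submodule K W, finrank K l = 2 ∧ weightSum 𝓔 l = 1
    · obtain ⟨l, hl, hlw⟩ := hex
      exact Or.inl (h.exists_point_of_line hl hlw)
    · push Not at hex
      obtain ⟨U, hU, hle⟩ := h.exists_ne_top_of_forall_line hex
      obtain ⟨f, hf, hUf⟩ := Submodule.exists_le_ker_of_lt_top U (lt_top_iff_ne_top.2 hU)
      refine Or.inr ⟨LinearMap.ker f, ?_, fun X hX => (hle X hX).trans hUf⟩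
      have := Module.Dual.finrank_ker_add_one_of_ne_zero hf
      omega

end EqualityCase

/-! ### Flags of planes and solids, and the sets `Λ(H, 𝓔)` -/

section Flags

variable {K V : Type*} [Field K] [AddCommGroup V] [Module K V]

theorem FlagOfType.exists_eq_pair [FiniteDimensional K V]
    (F : FlagOfType (⊤ : Submodule K V) {2, 3}) : ∃ E S : Submodule K V, F.1 = {E, S} ∧
      finrank K E = 3 ∧ finrank K S = 4 ∧ E ≤ S := by
  obtain ⟨F, ⟨h1, h2⟩, h3⟩ := F
  obtain ⟨E, hE, hE3⟩ : ∃ U ∈ F, HasProjDim U 2 := by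
    change 2 ∈ flagType F
    simp [h3]
  obtain ⟨S, hS, hS4⟩ : ∃ U ∈ F, HasProjDim U 3 := by
    change 3 ∈ flagType F
    simp [h3]
  rw [HasProjDim] at hE3 hS4
  have huniq : ∀ U ∈ F, ∀ U' ∈ F, finrank K U = finrank K U' → U = U' := by
    intro U hU U' hU' heq
    rcases h2 U hU U' hU' with hle | hle
    · exact Submodule.eq_of_le_of_finrank_eq hle heq
    · exact (Submodule.eq_of_le_of_finrank_eq hle heq.symm).symm
  refine ⟨E, S, ?_, hE3, hS4, ?_⟩
  · ext U
    simp only [Set.mem_insert_iff, Set.mem_singleton_iff]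
    constructor
    · intro hU
      have h4 : finrank K U ≠ 0 := fun h0 => (h1 U hU).2.1 (Submodule.finrank_eq_zero.1 h0)
      have h5 : finrank K U - 1 ∈ flagType F := ⟨U, hU, by rw [HasProjDim]; omega⟩
      rw [h3] at h5
      rcases h5 with h5 | h5
      · exact Or.inl (huniq U hU E hE (by omega))
      · rw [Set.mem_singleton_iff] at h5
        exact Or.inr (huniq U hU S hS (by omega))
    · rintro (rfl | rfl)
      · exact hE
      · exact hS
  · rcases h2 E hE S hS with hle | hle
    · exact hle
    · have := Submodule.finrank_mono hle
      omega

theorem isFlag_pair (hV : finrank K V = 7) {E S : Submodule K V} (hE : finrank K E = 3)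
    (hS : finrank K S = 4) (hES : E ≤ S) :
    IsFlag (⊤ : Submodule K V) {E, S} ∧ flagType ({E, S} : Set (Submodule K V)) = {2, 3} := by
  have hne : ∀ U : Submodule K V, finrank K U = 3 ∨ finrank K U = 4 → U ≤ ⊤ ∧ U ≠ ⊥ ∧ U ≠ ⊤ := by
    intro U hU
    refine ⟨le_top, ?_, ?_⟩
    · rintro rfl
      rw [finrank_bot] at hU
      omega
    · rintro rfl
      rw [finrank_top] at hU
      omega
  refine ⟨⟨?_, ?_⟩, ?_⟩
  · rintro U (rfl | rfl)
    · exact hne U (Or.inl hE)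
    · exact hne U (Or.inr hS)
  · rintro U (rfl | rfl) U' (rfl | rfl)
    · exact Or.inl le_rfl
    · exact Or.inl hES
    · exact Or.inr hES
    · exact Or.inl le_rfl
  · ext d
    simp only [flagType, HasProjDim, Set.mem_ofPred_eq, Set.mem_insert_iff, Set.mem_singleton_iff]
    constructor
    · rintro ⟨U, rfl | rfl, h⟩
      · left; omega
      · right; omega
    · rintro (rfl | rfl)
      · exact ⟨E, Or.inl rfl, hE⟩
      · exact ⟨S, Or.inr rfl, hS⟩

theorem pair_eq_pair {E S E' S' : Submodule K V} (hE : finrank K E = 3) (hS : finrank K S = 4)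
    (hE' : finrank K E' = 3) (hS' : finrank K S' = 4)
    (h : ({E, S} : Set (Submodule K V)) = {E', S'}) : E = E' ∧ S = S' := by
  constructor
  · have : E ∈ ({E', S'} : Set (Submodule K V)) := h ▸ Or.inl rfl
    rcases this with rfl | h1
    · rfl
    · rw [Set.mem_singleton_iff] at h1
      subst h1
      omega
  · have : S ∈ ({E', S'} : Set (Submodule K V)) := h ▸ Or.inr rfl
    rcases this with rfl | h1
    · omega
    · exact h1

variable {H : Submodule K V}

/-- Membership in `Λ(H, 𝓔)` of the flag of the plane `E` and the solid `S`. -/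
theorem mem_Lam_iff {𝓔 : Set (SubspaceOfDim H 2)} {F : FlagOfType (⊤ : Submodule K V) {2, 3}}
    {E S : Submodule K V} (hF : F.1 = {E, S}) (hE : finrank K E = 3) (hS : finrank K S = 4) :
    F ∈ Lam H 𝓔 ↔ S ≤ H ∨ E ∈ Subtype.val '' 𝓔 := by
  simp only [Lam, Set.mem_ofPred_eq, hF, Set.mem_insert_iff, Set.mem_singleton_iff, HasProjDim]
  refine or_congr ?_ ?_
  · constructor
    · rintro ⟨X, rfl | rfl, h1, h2⟩
      · omega
      · exact h2
    · intro h
      exact ⟨S, Or.inr rfl, hS, h⟩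
  · constructor
    · rintro ⟨X, hX, h | h⟩
      · exact ⟨X, hX, h⟩
      · have h1 : finrank K X.1 = 3 := X.2.2
        rw [h] at h1
        omega
    · rintro ⟨X, hX, h⟩
      exact ⟨X, hX, Or.inl h⟩

variable [FiniteDimensional K V]

theorem inf_ne_bot_of_finrank {X Y H : Submodule K V} (hX : X ≤ H) (hY : Y ≤ H)
    (h : finrank K H < finrank K X + finrank K Y) : X ⊓ Y ≠ ⊥ := by
  intro hXY
  have h1 := Submodule.finrank_sup_add_finrank_inf_eq X Y
  rw [hXY, finrank_bot] at h1
  have h2 := Submodule.finrank_mono (sup_le hX hY)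
  omega

/-- In a five-dimensional projective space, planes are adjacent exactly if they are disjoint. -/
theorem isIndepSet_planes_iff (hH : finrank K H = 6) {𝓔 : Set (SubspaceOfDim H 2)} :
    (kneserGraphSubspaces H 2).IsIndepSet 𝓔 ↔
      ∀ X ∈ 𝓔, ∀ Y ∈ 𝓔, X.1 ⊓ Y.1 ≠ ⊥ := by
  have hdim : ∀ X : SubspaceOfDim H 2, finrank K X.1 = 3 := fun X => X.2.2
  have hbot : ∀ X : SubspaceOfDim H 2, X.1 ≠ ⊥ := by
    intro X h0
    have := hdim X
    rw [h0, finrank_bot] at this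
    omega
  constructor
  · intro h X hX Y hY hXY
    have hne : X ≠ Y := by
      rintro rfl
      rw [inf_idem] at hXY
      exact hbot X hXY
    refine h hX hY hne ⟨hne, ?_⟩
    rintro U rfl U' rfl
    exact Or.inl hXY
  · rintro h X hX Y hY - ⟨-, hgp⟩
    rcases hgp X.1 rfl Y.1 rfl with h1 | h1
    · exact h X hX Y hY h1
    · have h2 := Submodule.finrank_sup_add_finrank_inf_eq X.1 Y.1
      rw [h1, hdim, hdim, hH] at h2
      exact h X hX Y hY (Submodule.finrank_eq_zero.1 (by omega))

/-- Two flags of `Λ(H, 𝓔)` have members in `H` that meet, and whose span then lies in `H`. -/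
theorem isIndepSet_Lam (hV : finrank K V = 7) (hH : finrank K H = 6)
    {𝓔 : Set (SubspaceOfDim H 2)} (h𝓔 : (kneserGraphSubspaces H 2).IsIndepSet 𝓔) :
    (kneserGraph (⊤ : Submodule K V) {2, 3}).IsIndepSet (Lam H 𝓔) := by
  rw [isIndepSet_planes_iff hH] at h𝓔
  have hHtop : H ≠ ⊤ := by
    rintro rfl
    rw [finrank_top] at hH
    omega
  have hno : ∀ {F F' : FlagOfType (⊤ : Submodule K V) {2, 3}} {X Y : Submodule K V},
      X ∈ F.1 → Y ∈ F'.1 → X ≤ H → Y ≤ H → X ⊓ Y ≠ ⊥ →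
        ¬(kneserGraph (⊤ : Submodule K V) {2, 3}).Adj F F' := by
    rintro F F' X Y hX hY hXH hYH hXY ⟨-, hgp⟩
    rcases hgp X hX Y hY with h | h
    · exact hXY h
    · exact hHtop (top_le_iff.1 (h ▸ sup_le hXH hYH))
  rintro F hF F' hF' -
  have hplane : ∀ X : SubspaceOfDim H 2, finrank K X.1 = 3 := fun X => X.2.2
  rcases hF with ⟨S, hS, hS4, hSH⟩ | ⟨E, hE, hEF⟩ <;>
    rcases hF' with ⟨S', hS', hS4', hSH'⟩ | ⟨E', hE', hEF'⟩
  · rw [HasProjDim] at hS4 hS4'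
    exact hno hS hS' hSH hSH' (inf_ne_bot_of_finrank hSH hSH' (by omega))
  · rw [HasProjDim] at hS4
    have := hplane E'
    exact hno hS hEF' hSH E'.2.1 (inf_ne_bot_of_finrank hSH E'.2.1 (by omega))
  · rw [HasProjDim] at hS4'
    have := hplane E
    exact hno hEF hS' E.2.1 hSH' (inf_ne_bot_of_finrank E.2.1 hSH' (by omega))
  · exact hno hEF hEF' E.2.1 E'.2.1 (h𝓔 E hE E' hE')

theorem finrank_inf_hyperplane (hV : finrank K V = 7) (hH : finrank K H = 6) {X : Submodule K V}
    (hX : ¬X ≤ H) : finrank K ↥(X ⊓ H) + 1 = finrank K X := by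
  have h1 := Submodule.finrank_sup_add_finrank_inf_eq X H
  have h2 : finrank K H < finrank K ↥(X ⊔ H) := Submodule.finrank_lt_finrank_of_lt
    (lt_of_le_of_ne le_sup_right fun h => hX (h ▸ le_sup_left))
  have h3 := Submodule.finrank_le (X ⊔ H)
  omega

theorem exists_disjoint_sup_eq_finrank {A B : Submodule K V} (hAB : A ≤ B) :
    ∃ T : Submodule K V, A ⊓ T = ⊥ ∧ A ⊔ T = B ∧ finrank K A + finrank K T = finrank K B := by
  obtain ⟨T, h1, h2⟩ := IsModularLattice.exists_disjoint_and_sup_eq hAB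
  have h3 := Submodule.finrank_sup_add_finrank_inf_eq A T
  rw [h2, h1.eq_bot, finrank_bot] at h3
  exact ⟨T, h1.eq_bot, h2, by omega⟩

/-- A flag whose solid is not in `H` and whose plane is not in `H` either is in general position to
some flag whose solid is in `H`. -/
theorem exists_adj_of_not_le (hV : finrank K V = 7) (hH : finrank K H = 6)
    {F : FlagOfType (⊤ : Submodule K V) {2, 3}} {E S : Submodule K V} (hF : F.1 = {E, S})
    (hE : finrank K E = 3) (hS : finrank K S = 4) (hES : E ≤ S) (hEH : ¬E ≤ H) :
    ∃ F' ∈ Lam H ∅, (kneserGraph (⊤ : Submodule K V) {2, 3}).Adj F F' := by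
  have hSH : ¬S ≤ H := fun h => hEH (hES.trans h)
  have hE2 := finrank_inf_hyperplane hV hH hEH
  have hS3 := finrank_inf_hyperplane hV hH hSH
  -- The solid of the new flag is a complement in `H` of the line `E ⊓ H`.
  obtain ⟨T, hT1, hT2, hT3⟩ := exists_disjoint_sup_eq_finrank (inf_le_right : E ⊓ H ≤ H)
  have hTH : T ≤ H := hT2 ▸ le_sup_right
  have hET : E ⊓ T = ⊥ := by
    rw [← hT1, inf_assoc, inf_eq_right.2 hTH]
  have hST : S ⊓ T = (S ⊓ H) ⊓ T := by rw [inf_assoc, inf_eq_right.2 hTH]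
  have hST1 : finrank K ↥(S ⊓ T) = 1 := by
    have h1 := Submodule.finrank_sup_add_finrank_inf_eq (S ⊓ H) T
    have h2 : (S ⊓ H) ⊔ T = H := le_antisymm (sup_le inf_le_right hTH)
      (hT2.symm.le.trans (sup_le_sup_right (inf_le_inf_right H hES) T))
    rw [h2, ← hST] at h1
    omega
  have hSTtop : S ⊔ T = ⊤ := by
    have h1 := Submodule.finrank_sup_add_finrank_inf_eq S T
    exact Submodule.eq_top_of_finrank_eq (by omega)
  -- Its plane is a complement in `T` of the point `S ⊓ T`.
  obtain ⟨E', h1, h2, h3⟩ := exists_disjoint_sup_eq_finrank (inf_le_right : S ⊓ T ≤ T)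
  have hE'T : E' ≤ T := h2 ▸ le_sup_right
  have hSE' : S ⊓ E' = ⊥ := by
    rw [← h1, inf_assoc, inf_eq_right.2 hE'T]
  have hE'3 : finrank K E' = 3 := by omega
  have hT4 : finrank K T = 4 := by omega
  let F' : FlagOfType (⊤ : Submodule K V) {2, 3} := ⟨{E', T}, isFlag_pair hV hE'3 hT4 hE'T⟩
  refine ⟨F', (mem_Lam_iff rfl hE'3 hT4).2 (Or.inl hTH), ?_, ?_⟩
  · rintro rfl
    obtain ⟨-, rfl⟩ := pair_eq_pair hE'3 hT4 hE hS hF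
    exact hSH hTH
  · rw [hF]
    rintro U (rfl | rfl) U' (rfl | rfl)
    · exact Or.inl (le_bot_iff.1 (hET ▸ inf_le_inf_left U hE'T))
    · exact Or.inl hET
    · exact Or.inl hSE'
    · exact Or.inr hSTtop

/-- Flags through disjoint planes of `H` whose solids are not in `H` are in general position. -/
theorem adj_of_inf_eq_bot (hV : finrank K V = 7) (hH : finrank K H = 6)
    {F F' : FlagOfType (⊤ : Submodule K V) {2, 3}} {E S E' S' : Submodule K V}
    (hF : F.1 = {E, S}) (hF' : F'.1 = {E', S'}) (hE : finrank K E = 3) (hS : finrank K S = 4)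
    (hE' : finrank K E' = 3) (hS' : finrank K S' = 4) (hES : E ≤ S) (hES' : E' ≤ S')
    (hEH : E ≤ H) (hEH' : E' ≤ H) (hSH : ¬S ≤ H) (hSH' : ¬S' ≤ H) (hEE' : E ⊓ E' = ⊥) :
    (kneserGraph (⊤ : Submodule K V) {2, 3}).Adj F F' := by
  have hinf : ∀ {E S : Submodule K V}, finrank K E = 3 → finrank K S = 4 → E ≤ S → E ≤ H →
      ¬S ≤ H → S ⊓ H = E := by
    intro E S hE hS hES hEH hSH
    have := finrank_inf_hyperplane hV hH hSH
    exact (Submodule.eq_of_le_of_finrank_eq (le_inf hES hEH) (by omega)).symm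
  have hSE' : S ⊓ E' = ⊥ := by
    rw [← inf_eq_right.2 hEH', ← inf_assoc, hinf hE hS hES hEH hSH, hEE']
  have hES'bot : E ⊓ S' = ⊥ := by
    rw [← inf_eq_left.2 hEH, inf_assoc, inf_comm H, hinf hE' hS' hES' hEH' hSH', hEE']
  have hsup : E ⊔ E' = H := by
    have h1 := Submodule.finrank_sup_add_finrank_inf_eq E E'
    rw [hEE', finrank_bot] at h1
    exact Submodule.eq_of_le_of_finrank_eq (sup_le hEH hEH') (by omega)
  have hSS' : S ⊔ S' = ⊤ := by
    have h1 : H ≤ S ⊔ S' := hsup ▸ sup_le_sup hES hES'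
    have h2 : finrank K H < finrank K ↥(S ⊔ S') := Submodule.finrank_lt_finrank_of_lt
      (lt_of_le_of_ne h1 fun h => hSH (h ▸ le_sup_left))
    have h3 := Submodule.finrank_le (S ⊔ S')
    exact Submodule.eq_top_of_finrank_eq (by omega)
  refine ⟨?_, ?_⟩
  · rintro rfl
    obtain ⟨rfl, -⟩ := pair_eq_pair hE hS hE' hS' (hF.symm.trans hF')
    rw [inf_idem] at hEE'
    rw [hEE', finrank_bot] at hE
    omega
  · rw [hF, hF']
    rintro U (rfl | rfl) U' (rfl | rfl)
    · exact Or.inl hEE'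
    · exact Or.inl hES'bot
    · exact Or.inl hSE'
    · exact Or.inr hSS'

/-- An independent set of flags that contains `Λ(H, ∅)` is contained in `Λ(H, 𝓔)`, where `𝓔`
consists of the planes of its flags whose solid is not in `H`. -/
theorem exists_subset_Lam (hV : finrank K V = 7) (hH : finrank K H = 6)
    {C : Set (FlagOfType (⊤ : Submodule K V) {2, 3})}
    (hC : (kneserGraph (⊤ : Submodule K V) {2, 3}).IsIndepSet C) (hLam : Lam H ∅ ⊆ C) :
    ∃ 𝓔 : Set (SubspaceOfDim H 2), (kneserGraphSubspaces H 2).IsIndepSet 𝓔 ∧ C ⊆ Lam H 𝓔 := by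
  have hEH : ∀ {F : FlagOfType (⊤ : Submodule K V) {2, 3}} {E S : Submodule K V}, F ∈ C →
      F.1 = {E, S} → finrank K E = 3 → finrank K S = 4 → E ≤ S → E ≤ H := by
    intro F E S hFC hF hE hS hES
    by_contra hEH
    obtain ⟨F', hF', hadj⟩ := exists_adj_of_not_le hV hH hF hE hS hES hEH
    exact hC hFC (hLam hF') hadj.ne hadj
  refine ⟨{X | ∃ F ∈ C, ∃ S : Submodule K V, F.1 = {X.1, S} ∧ finrank K S = 4 ∧ X.1 ≤ S ∧
    ¬S ≤ H}, ?_, ?_⟩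
  · rw [isIndepSet_planes_iff hH]
    rintro ⟨E, hEH1, hE⟩ ⟨F, hFC, S, hF, hS, hES, hSH⟩ ⟨E', hEH1', hE'⟩
      ⟨F', hFC', S', hF', hS', hES', hSH'⟩ hEE'
    have hadj := adj_of_inf_eq_bot hV hH hF hF' hE hS hE' hS' hES hES' hEH1 hEH1' hSH hSH' hEE'
    exact hC hFC hFC' hadj.ne hadj
  · intro F hFC
    obtain ⟨E, S, hF, hE, hS, hES⟩ := FlagOfType.exists_eq_pair F
    rw [mem_Lam_iff hF hE hS]
    by_cases hSH : S ≤ H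
    · exact Or.inl hSH
    · exact Or.inr ⟨⟨E, hEH hFC hF hE hS hES, hE⟩, ⟨F, hFC, S, hF, hS, hES, hSH⟩, rfl⟩

theorem subset_of_Lam_subset (hV : finrank K V = 7) (hH : finrank K H = 6)
    {𝓔 𝓔' : Set (SubspaceOfDim H 2)} (h : Lam H 𝓔 ⊆ Lam H 𝓔') : 𝓔 ⊆ 𝓔' := by
  intro X hX
  have hX3 : finrank K X.1 = 3 := X.2.2
  obtain ⟨v, -, hv⟩ := SetLike.exists_of_lt (lt_top_iff_ne_top.2 fun htop : H = ⊤ => by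
    rw [htop, finrank_top] at hH
    omega)
  have hv0 : v ≠ 0 := fun h0 => hv (h0 ▸ H.zero_mem)
  have hS : finrank K ↥(X.1 ⊔ Submodule.span K {v}) = 4 := by
    have h1 := Submodule.finrank_sup_add_finrank_inf_eq X.1 (Submodule.span K {v})
    have h2 := Submodule.finrank_mono (X.2.1)
    have h3 : X.1 ⊓ Submodule.span K {v} = ⊥ := by
      rw [← disjoint_iff, Submodule.disjoint_span_singleton' hv0]
      exact fun hvX => hv (X.2.1 hvX)
    rw [h3, finrank_bot, finrank_span_singleton hv0, hX3] at h1
    omega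
  have hSH : ¬X.1 ⊔ Submodule.span K {v} ≤ H := fun hle =>
    hv (hle (le_sup_right (a := X.1) (Submodule.mem_span_singleton_self v)))
  let F : FlagOfType (⊤ : Submodule K V) {2, 3} := ⟨_, isFlag_pair hV hX3 hS le_sup_left⟩
  have hF := h ((mem_Lam_iff (F := F) rfl hX3 hS).2 (Or.inr ⟨X, hX, rfl⟩))
  obtain ⟨Y, hY, hYX⟩ := ((mem_Lam_iff (F := F) rfl hX3 hS).1 hF).resolve_left hSH
  exact Subtype.ext hYX ▸ hY

omit [FiniteDimensional K V] in
theorem Lam_mono {𝓔 𝓔' : Set (SubspaceOfDim H 2)} (h : 𝓔 ⊆ 𝓔') : Lam H 𝓔 ⊆ Lam H 𝓔' := by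
  rintro F (hF | ⟨E, hE, hEF⟩)
  · exact Or.inl hF
  · exact Or.inr ⟨E, h hE, hEF⟩

/-- The maximal independent sets of flags containing `Λ(H, ∅)` come from the maximal independent
sets of planes of `H`. -/
theorem maximal_isIndepSet_iff (hV : finrank K V = 7) (hH : finrank K H = 6)
    (C : Set (FlagOfType (⊤ : Submodule K V) {2, 3})) :
    (Maximal (kneserGraph (⊤ : Submodule K V) {2, 3}).IsIndepSet C ∧ Lam H ∅ ⊆ C) ↔
      ∃ 𝓔 : Set (SubspaceOfDim H 2),
        Maximal (kneserGraphSubspaces H 2).IsIndepSet 𝓔 ∧ C = Lam H 𝓔 := by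
  constructor
  · rintro ⟨hC, hLam⟩
    obtain ⟨𝓔, h𝓔, hsub⟩ := exists_subset_Lam hV hH hC.prop hLam
    have heq : C = Lam H 𝓔 := hC.eq_of_subset (isIndepSet_Lam hV hH h𝓔) hsub
    refine ⟨𝓔, ⟨h𝓔, fun 𝓔' h𝓔' hle => ?_⟩, heq⟩
    refine subset_of_Lam_subset hV hH ?_
    rw [← heq]
    exact hC.le_of_ge (isIndepSet_Lam hV hH h𝓔') (heq.le.trans (Lam_mono hle))
  · rintro ⟨𝓔, h𝓔, rfl⟩
    refine ⟨⟨isIndepSet_Lam hV hH h𝓔.prop, fun D hD hle => ?_⟩, Lam_mono (Set.empty_subset 𝓔)⟩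
    obtain ⟨𝓔', h𝓔', hsub⟩ := exists_subset_Lam hV hH hD
      ((Lam_mono (Set.empty_subset 𝓔)).trans hle)
    exact hsub.trans (Lam_mono (h𝓔.le_of_ge h𝓔' (subset_of_Lam_subset hV hH (hle.trans hsub))))

end Flags

/-! ### The size of `Λ(H, 𝓔)` -/

section LamCard

variable {K V : Type*} [Field K] [AddCommGroup V] [Module K V] [Finite K] [Finite V]
  {H : Submodule K V}

/-- The planes in `𝓔`, as a finite set of subspaces of `V`. -/
noncomputable def planes (𝓔 : Set (SubspaceOfDim H 2)) : Finset (Submodule K V) :=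
  (Set.toFinite (Subtype.val '' 𝓔)).toFinset

omit [Finite K] in
theorem mem_planes {𝓔 : Set (SubspaceOfDim H 2)} {E : Submodule K V} :
    E ∈ planes 𝓔 ↔ E ∈ Subtype.val '' 𝓔 := by
  rw [planes, Set.Finite.mem_toFinset]

omit [Finite K] in
theorem card_planes (𝓔 : Set (SubspaceOfDim H 2)) : (planes 𝓔).card = 𝓔.ncard := by
  rw [← Set.ncard_image_of_injective 𝓔 Subtype.val_injective, planes,
    Set.ncard_eq_toFinset_card _ (Set.toFinite _)]

omit [Finite K] in
theorem le_and_finrank_of_mem_planes {𝓔 : Set (SubspaceOfDim H 2)} {E : Submodule K V}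
    (hE : E ∈ planes 𝓔) : E ≤ H ∧ finrank K E = 3 := by
  obtain ⟨X, -, rfl⟩ := mem_planes.1 hE
  exact X.2

/-- The solids through a plane of `H` that are not contained in `H`. -/
theorem card_solids_not_le (hV : finrank K V = 7) (hH : finrank K H = 6) {E : Submodule K V}
    (hEH : E ≤ H) (hE : finrank K E = 3) [DecidablePred fun S : Submodule K V => ¬S ≤ H] :
    (((subs E ⊤ 4).filter fun S => ¬S ≤ H).card : ℚ) = (Nat.card K : ℚ) ^ 3 := by
  classical
  have h1 := card_subs_covering (le_top : E ≤ ⊤) 4 hE (by rw [finrank_top, hV])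
  have h2 := card_subs_covering hEH 3 hE (by rw [hH])
  have h3 := Finset.card_filter_add_card_filter_not (s := subs E ⊤ 4) (fun S => S ≤ H)
  have h4 : (subs E ⊤ 4).filter (fun S => S ≤ H) = subs E H 4 := by
    ext S
    simp only [Finset.mem_filter, mem_subs, le_top, true_and]
    tauto
  rw [h4, ← Nat.cast_inj (R := ℚ)] at h3
  push_cast at h3
  rw [h2, h1] at h3
  simp only [Finset.sum_range_succ, Finset.sum_range_zero] at h3
  convert! add_left_cancel h3 using 2

/-- The size of `Λ(H, 𝓔)`: the flags whose solid is in `H`, and those whose plane is in `𝓔` and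
whose solid is not in `H`. -/
theorem ncard_Lam (hV : finrank K V = 7) (hH : finrank K H = 6) (𝓔 : Set (SubspaceOfDim H 2)) :
    ((Lam H 𝓔).ncard : ℚ) = ((Nat.card K : ℚ) ^ 4 + (Nat.card K : ℚ) ^ 2 + 1) *
      ((Nat.card K : ℚ) ^ 4 + (Nat.card K : ℚ) ^ 3 + (Nat.card K : ℚ) ^ 2 + Nat.card K + 1) *
      ((Nat.card K : ℚ) ^ 3 + (Nat.card K : ℚ) ^ 2 + Nat.card K + 1) +
      𝓔.ncard * (Nat.card K : ℚ) ^ 3 := by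
  classical
  have : FiniteDimensional K V := Module.Finite.of_finite
  let inH : Finset (Σ _ : Submodule K V, Submodule K V) := (subs ⊥ H 4).sigma fun S => subs ⊥ S 3
  let offH : Finset (Σ _ : Submodule K V, Submodule K V) :=
    (planes 𝓔).sigma fun E => (subs E ⊤ 4).filter fun S => ¬S ≤ H
  let A : Set (Set (Submodule K V)) := (fun p : Σ _ : Submodule K V, Submodule K V =>
    ({p.2, p.1} : Set (Submodule K V))) '' inH
  let B : Set (Set (Submodule K V)) := (fun p : Σ _ : Submodule K V, Submodule K V =>
    ({p.1, p.2} : Set (Submodule K V))) '' offH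
  have hin : ∀ {S E : Submodule K V}, (⟨S, E⟩ : Σ _ : Submodule K V, Submodule K V) ∈ inH ↔
      (S ≤ H ∧ finrank K S = 4) ∧ E ≤ S ∧ finrank K E = 3 := by
    intro S E
    simp [inH]
  have hoff : ∀ {S E : Submodule K V}, (⟨E, S⟩ : Σ _ : Submodule K V, Submodule K V) ∈ offH ↔
      E ∈ planes 𝓔 ∧ (E ≤ S ∧ finrank K S = 4) ∧ ¬S ≤ H := by
    intro S E
    simp [offH]
  have hunion : Subtype.val '' Lam H 𝓔 = A ∪ B := by
    ext F
    constructor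
    · rintro ⟨F, hF, rfl⟩
      obtain ⟨E, S, hFES, hE, hS, hES⟩ := FlagOfType.exists_eq_pair F
      rw [mem_Lam_iff hFES hE hS] at hF
      by_cases hSH : S ≤ H
      · exact Or.inl ⟨⟨S, E⟩, hin.2 ⟨⟨hSH, hS⟩, hES, hE⟩, hFES.symm⟩
      · exact Or.inr ⟨⟨E, S⟩, hoff.2 ⟨mem_planes.2 (hF.resolve_left hSH), ⟨hES, hS⟩, hSH⟩,
          hFES.symm⟩
    · rintro (⟨⟨S, E⟩, hp, rfl⟩ | ⟨⟨E, S⟩, hp, rfl⟩)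
      · obtain ⟨⟨hSH, hS⟩, hES, hE⟩ := hin.1 hp
        exact ⟨⟨{E, S}, isFlag_pair hV hE hS hES⟩, (mem_Lam_iff rfl hE hS).2 (Or.inl hSH), rfl⟩
      · obtain ⟨hE𝓔, ⟨hES, hS⟩, -⟩ := hoff.1 hp
        have hE := (le_and_finrank_of_mem_planes hE𝓔).2
        exact ⟨⟨{E, S}, isFlag_pair hV hE hS hES⟩,
          (mem_Lam_iff rfl hE hS).2 (Or.inr (mem_planes.1 hE𝓔)), rfl⟩
  have hdisj : Disjoint A B := by
    rw [Set.disjoint_left]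
    rintro F ⟨⟨S, E⟩, hp, rfl⟩ ⟨⟨E', S'⟩, hp', heq⟩
    obtain ⟨⟨hSH, hS⟩, hES, hE⟩ := hin.1 hp
    obtain ⟨hE𝓔, ⟨hES', hS'⟩, hSH'⟩ := hoff.1 hp'
    obtain ⟨-, rfl⟩ := pair_eq_pair (le_and_finrank_of_mem_planes hE𝓔).2 hS' hE hS heq
    exact hSH' hSH
  have hA : A.ncard = inH.card := by
    rw [Set.InjOn.ncard_image, Set.ncard_coe_finset]
    rintro ⟨S, E⟩ hp ⟨S', E'⟩ hp' heq
    obtain ⟨⟨-, hS⟩, -, hE⟩ := hin.1 hp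
    obtain ⟨⟨-, hS'⟩, -, hE'⟩ := hin.1 hp'
    obtain ⟨rfl, rfl⟩ := pair_eq_pair hE hS hE' hS' heq
    rfl
  have hB : B.ncard = offH.card := by
    rw [Set.InjOn.ncard_image, Set.ncard_coe_finset]
    rintro ⟨E, S⟩ hp ⟨E', S'⟩ hp' heq
    obtain ⟨hE, ⟨-, hS⟩, -⟩ := hoff.1 hp
    obtain ⟨hE', ⟨-, hS'⟩, -⟩ := hoff.1 hp'
    obtain ⟨rfl, rfl⟩ := pair_eq_pair (le_and_finrank_of_mem_planes hE).2 hS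
      (le_and_finrank_of_mem_planes hE').2 hS' heq
    rfl
  have hcard : (Lam H 𝓔).ncard = inH.card + offH.card := by
    rw [← Set.ncard_image_of_injective _ Subtype.val_injective, hunion,
      Set.ncard_union_eq hdisj, hA, hB]
  rw [hcard, Nat.cast_add, Finset.card_sigma, Finset.card_sigma, Nat.cast_sum, Nat.cast_sum]
  congr 1
  · rw [Finset.sum_congr rfl fun S hS => by
      rw [show 3 = 0 + 3 from rfl, card_subs_codim_four bot_le (finrank_bot K V)
        (by rw [(mem_subs.1 hS).2.2])], Finset.sum_const, nsmul_eq_mul, show 4 = 0 + 4 from rfl,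
      card_subs_six_four bot_le (finrank_bot K V) (by rw [hH])]
  · rw [Finset.sum_congr rfl fun E hE => card_solids_not_le hV hH
      (le_and_finrank_of_mem_planes hE).1 (le_and_finrank_of_mem_planes hE).2,
      Finset.sum_const, nsmul_eq_mul, card_planes]

/-- The Erdős–Ko–Rado theorem for planes, applied in `H`. -/
theorem erdosKoRado_hyperplane (hH : finrank K H = 6) {𝓔 : Set (SubspaceOfDim H 2)}
    (h𝓔 : (kneserGraphSubspaces H 2).IsIndepSet 𝓔) :
    (𝓔.ncard : ℚ) ≤ (Nat.card K : ℚ) ^ 6 + (Nat.card K : ℚ) ^ 5 + 2 * (Nat.card K : ℚ) ^ 4 +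
      2 * (Nat.card K : ℚ) ^ 3 + 2 * (Nat.card K : ℚ) ^ 2 + Nat.card K + 1 ∧
    ((𝓔.ncard : ℚ) = (Nat.card K : ℚ) ^ 6 + (Nat.card K : ℚ) ^ 5 + 2 * (Nat.card K : ℚ) ^ 4 +
      2 * (Nat.card K : ℚ) ^ 3 + 2 * (Nat.card K : ℚ) ^ 2 + Nat.card K + 1 →
      (∃ P : Submodule K V, finrank K P = 1 ∧ P ≤ H ∧ ∀ X ∈ 𝓔, P ≤ X.1) ∨
      ∃ U : Submodule K V, finrank K U = 5 ∧ U ≤ H ∧ ∀ X ∈ 𝓔, X.1 ≤ U) := by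
  classical
  have : FiniteDimensional K V := Module.Finite.of_finite
  rw [isIndepSet_planes_iff hH] at h𝓔
  let f : SubspaceOfDim H 2 → Submodule K H := fun X => X.1.submoduleOf H
  have hmap : ∀ X : SubspaceOfDim H 2, (f X).map H.subtype = X.1 := fun X => by
    change (X.1.submoduleOf H).map H.subtype = X.1
    rw [Submodule.submoduleOf, Submodule.map_comap_subtype, inf_eq_right.2 X.2.1]
  have hf : Function.Injective f := fun X Y hXY =>
    Subtype.ext (by rw [← hmap X, ← hmap Y, hXY])
  have hfin : (f '' 𝓔).Finite := Set.toFinite _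
  have hcard : hfin.toFinset.card = 𝓔.ncard := by
    rw [← Set.ncard_eq_toFinset_card _ hfin, Set.ncard_image_of_injective 𝓔 hf]
  have h3 : ∀ X ∈ hfin.toFinset, finrank K X = 3 := by
    intro X hX
    obtain ⟨Y, -, rfl⟩ := hfin.mem_toFinset.1 hX
    exact (Submodule.submoduleOfEquivOfLe Y.2.1).finrank_eq.trans Y.2.2
  have hint : ∀ X ∈ hfin.toFinset, ∀ Y ∈ hfin.toFinset, X ⊓ Y ≠ ⊥ := by
    intro X hX Y hY hXY
    obtain ⟨X, hX𝓔, rfl⟩ := hfin.mem_toFinset.1 hX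
    obtain ⟨Y, hY𝓔, rfl⟩ := hfin.mem_toFinset.1 hY
    refine h𝓔 X hX𝓔 Y hY𝓔 ?_
    rw [← hmap X, ← hmap Y, ← Submodule.map_inf _ H.subtype_injective, hXY, Submodule.map_bot]
  obtain ⟨h1, h2⟩ := erdosKoRado_planes hH h3 hint
  rw [hcard] at h1 h2
  refine ⟨h1, fun heq => ?_⟩
  rcases h2 heq with ⟨P, hP, hle⟩ | ⟨U, hU, hle⟩
  · refine Or.inl ⟨P.map H.subtype, (Submodule.finrank_map_subtype_eq H P).trans hP,
      Submodule.map_subtype_le H P, fun X hX => ?_⟩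
    rw [← hmap X]
    exact Submodule.map_mono (hle _ (hfin.mem_toFinset.2 ⟨X, hX, rfl⟩))
  · refine Or.inr ⟨U.map H.subtype, (Submodule.finrank_map_subtype_eq H U).trans hU,
      Submodule.map_subtype_le H U, fun X hX => ?_⟩
    rw [← hmap X]
    exact Submodule.map_mono (hle _ (hfin.mem_toFinset.2 ⟨X, hX, rfl⟩))

end LamCard

/-! ### The Gaussian coefficients of the statement -/

section GaussianCoefficients

variable {q : ℕ}

theorem s1_three (hq : 1 < q) : s1 q 3 = (q : ℚ) ^ 3 + (q : ℚ) ^ 2 + q + 1 := by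
  have hq' : (1 : ℚ) < q := by exact_mod_cast hq
  have h1 : (q : ℚ) - 1 ≠ 0 := by linarith
  have hI : Finset.Icc (1 : ℤ) 1 = {1} := by decide
  have h : s1 q 3 = ((q : ℚ) ^ 4 - 1) / ((q : ℚ) - 1) := by
    norm_num [s1, s2, s4, gauss, hI]
  rw [h, div_eq_iff h1]
  ring

theorem s2_three_five (hq : 1 < q) : s2 q 3 5 = ((q : ℚ) ^ 4 + (q : ℚ) ^ 2 + 1) *
    ((q : ℚ) ^ 4 + (q : ℚ) ^ 3 + (q : ℚ) ^ 2 + q + 1) := by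
  have hq' : (1 : ℚ) < q := by exact_mod_cast hq
  have hpow : ∀ n : ℕ, n ≠ 0 → (q : ℚ) ^ n - 1 ≠ 0 := fun n hn =>
    (sub_pos.2 (one_lt_pow₀ hq' hn)).ne'
  have hI : Finset.Icc (1 : ℤ) 4 = {1, 2, 3, 4} := by decide
  have h : s2 q 3 5 = (((q : ℚ) ^ 6 - 1) / ((q : ℚ) ^ 1 - 1)) *
      ((((q : ℚ) ^ 5 - 1) / ((q : ℚ) ^ 2 - 1)) * ((((q : ℚ) ^ 4 - 1) / ((q : ℚ) ^ 3 - 1)) *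
      (((q : ℚ) ^ 3 - 1) / ((q : ℚ) ^ 4 - 1)))) := by
    norm_num [s2, s4, gauss, hI, div_mul_div_comm, zpow_ofNat]
  have h1 := hpow 1 (by norm_num)
  have h2 := hpow 2 (by norm_num)
  have h3 := hpow 3 (by norm_num)
  have h4 := hpow 4 (by norm_num)
  rw [h, div_mul_div_comm, div_mul_div_comm, div_mul_div_comm, div_eq_iff (by positivity)]
  ring

theorem s2_one_four (hq : 1 < q) : s2 q 1 4 = (q : ℚ) ^ 6 + (q : ℚ) ^ 5 + 2 * (q : ℚ) ^ 4 +
    2 * (q : ℚ) ^ 3 + 2 * (q : ℚ) ^ 2 + q + 1 := by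
  have hq' : (1 : ℚ) < q := by exact_mod_cast hq
  have hpow : ∀ n : ℕ, n ≠ 0 → (q : ℚ) ^ n - 1 ≠ 0 := fun n hn =>
    (sub_pos.2 (one_lt_pow₀ hq' hn)).ne'
  have hI : Finset.Icc (1 : ℤ) 2 = {1, 2} := by decide
  have h : s2 q 1 4 = (((q : ℚ) ^ 5 - 1) / ((q : ℚ) ^ 1 - 1)) *
      (((q : ℚ) ^ 4 - 1) / ((q : ℚ) ^ 2 - 1)) := by
    norm_num [s2, s4, gauss, hI, div_mul_div_comm, zpow_ofNat]
  have h1 := hpow 1 (by norm_num)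
  have h2 := hpow 2 (by norm_num)
  rw [h, div_mul_div_comm, div_eq_iff (mul_ne_zero h1 h2)]
  ring

end GaussianCoefficients

end KneserPG

theorem proposition3p2 {K V : Type*} [Field K] [Finite K] [AddCommGroup V] [Module K V]
    (hV : Module.finrank K V = 7) (q : ℕ) (hq : q = Nat.card K)
    (H : Submodule K V) (hH : KneserPG.HasProjDim H 5) :
    -- part i)
    (KneserPG.kneserGraph (⊤ : Submodule K V) {2, 3}).IsIndepSet (KneserPG.Lam H ∅) ∧
    -- part ii)
    (∀ C : Set (KneserPG.FlagOfType (⊤ : Submodule K V) {2, 3}),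
      (Maximal (KneserPG.kneserGraph (⊤ : Submodule K V) {2, 3}).IsIndepSet C ∧
          KneserPG.Lam H ∅ ⊆ C) ↔
        ∃ 𝓔 : Set (KneserPG.SubspaceOfDim H 2),
          Maximal (KneserPG.kneserGraphSubspaces H 2).IsIndepSet 𝓔 ∧ C = KneserPG.Lam H 𝓔) ∧
    -- part iii)
    (∀ 𝓔 : Set (KneserPG.SubspaceOfDim H 2),
      Maximal (KneserPG.kneserGraphSubspaces H 2).IsIndepSet 𝓔 →
        ((KneserPG.Lam H 𝓔).ncard : ℚ) =
            KneserPG.s2 q 3 5 * KneserPG.s1 q 3 + (𝓔.ncard : ℚ) * (q : ℚ) ^ 3 ∧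
        (KneserPG.Lam H 𝓔).ncard ≤
          q ^ 11 + 2 * q ^ 10 + 5 * q ^ 9 + 7 * q ^ 8 + 10 * q ^ 7 + 11 * q ^ 6 + 11 * q ^ 5 +
            9 * q ^ 4 + 7 * q ^ 3 + 4 * q ^ 2 + 2 * q + 1 ∧
        ((KneserPG.Lam H 𝓔).ncard =
          q ^ 11 + 2 * q ^ 10 + 5 * q ^ 9 + 7 * q ^ 8 + 10 * q ^ 7 + 11 * q ^ 6 + 11 * q ^ 5 +
            9 * q ^ 4 + 7 * q ^ 3 + 4 * q ^ 2 + 2 * q + 1 ↔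
          (𝓔.ncard : ℚ) = KneserPG.s2 q 1 4) ∧
        ((KneserPG.Lam H 𝓔).ncard =
          q ^ 11 + 2 * q ^ 10 + 5 * q ^ 9 + 7 * q ^ 8 + 10 * q ^ 7 + 11 * q ^ 6 + 11 * q ^ 5 +
            9 * q ^ 4 + 7 * q ^ 3 + 4 * q ^ 2 + 2 * q + 1 →
          (∃ P : Submodule K V, KneserPG.HasProjDim P 0 ∧ P ≤ H ∧ 𝓔 = {E | P ≤ E.1}) ∨
          ∃ U : Submodule K V, KneserPG.HasProjDim U 4 ∧ U ≤ H ∧ 𝓔 = {E | E.1 ≤ U})) := by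
  subst hq
  have hH6 : Module.finrank K H = 6 := hH
  have : FiniteDimensional K V := Module.finite_of_finrank_pos (by omega)
  have : Finite V := Module.finite_of_finite K
  have hq1 : 1 < Nat.card K := Finite.one_lt_card
  refine ⟨KneserPG.isIndepSet_Lam hV hH6 (Set.pairwise_empty _),
    KneserPG.maximal_isIndepSet_iff hV hH6, fun 𝓔 h𝓔 => ?_⟩
  rw [KneserPG.s2_three_five hq1, KneserPG.s1_three hq1, KneserPG.s2_one_four hq1]
  have hcard := KneserPG.ncard_Lam hV hH6 𝓔
  obtain ⟨hle, hex⟩ := KneserPG.erdosKoRado_hyperplane hH6 h𝓔.prop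
  have hq0 : (0 : ℚ) < (Nat.card K : ℚ) ^ 3 := by
    have : (0 : ℚ) < Nat.card K := by exact_mod_cast zero_lt_one.trans hq1
    positivity
  have hiff : (KneserPG.Lam H 𝓔).ncard =
      Nat.card K ^ 11 + 2 * Nat.card K ^ 10 + 5 * Nat.card K ^ 9 + 7 * Nat.card K ^ 8 +
        10 * Nat.card K ^ 7 + 11 * Nat.card K ^ 6 + 11 * Nat.card K ^ 5 + 9 * Nat.card K ^ 4 +
        7 * Nat.card K ^ 3 + 4 * Nat.card K ^ 2 + 2 * Nat.card K + 1 ↔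
      (𝓔.ncard : ℚ) = (Nat.card K : ℚ) ^ 6 + (Nat.card K : ℚ) ^ 5 + 2 * (Nat.card K : ℚ) ^ 4 +
        2 * (Nat.card K : ℚ) ^ 3 + 2 * (Nat.card K : ℚ) ^ 2 + Nat.card K + 1 := by
    rw [← Nat.cast_inj (R := ℚ), hcard]
    push_cast
    constructor
    · intro h
      refine mul_right_cancel₀ hq0.ne' ?_
      linear_combination h
    · intro h
      rw [h]
      ring
  refine ⟨hcard, ?_, hiff, fun heq => ?_⟩
  · rw [← Nat.cast_le (α := ℚ), hcard]
    push_cast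
    linarith [mul_le_mul_of_nonneg_right hle hq0.le]
  -- The set of planes through `P` and the set of planes of `U` are independent, so that the
  -- maximal independent set `𝓔` is not a proper subset of either.
  · rcases hex (hiff.1 heq) with ⟨P, hP, hPH, hPE⟩ | ⟨U, hU, hUH, hUE⟩
    · refine Or.inl ⟨P, hP, hPH, h𝓔.eq_of_subset ?_ hPE⟩
      rw [KneserPG.isIndepSet_planes_iff hH6]
      intro X hX Y hY hXY
      have hPbot : P ≤ ⊥ := (le_inf hX hY).trans hXY.le
      rw [le_bot_iff.1 hPbot, finrank_bot] at hP
      omega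
    · refine Or.inr ⟨U, hU, hUH, h𝓔.eq_of_subset ?_ hUE⟩
      rw [KneserPG.isIndepSet_planes_iff hH6]
      intro X hX Y hY
      have hX3 : Module.finrank K X.1 = 3 := X.2.2
      have hY3 : Module.finrank K Y.1 = 3 := Y.2.2
      exact KneserPG.inf_ne_bot_of_finrank hX hY (by omega)
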